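/- Let $X$ be a locally compact separable metric space, $m$ a positive Radon measure on $X$ with full support, $H=L^2(X;m)$. Let $(E^{(t)},F)$, $t\in\mathbb R$, be $m$-symmetric, regular, local Dirichlet forms on $H$ with common domain $F$, such that $t\mapsto E^{(t)}(u,u)$ is measurable for each $u\in F$ and, for some $\lambda>0$, $\lambda^{-1}\|u\|_F^2\le E^{(t)}_1(u,u)\le\lambda\|u\|_F^2$ for all $t$ and $u\in F$, where $E^{(t)}_\beta=E^{(t)}+\beta(\cdot,\cdot)_m$ and $\|u\|_F^2=E^{(0)}_1(u,u)$. Let $F\subset H=H'\subset F'$, where $F'$ is the dual of $F$, and put $\mathscr H=L^2(\mathbb R;H)$, $\mathscr F=L^2(\mathbb R;F)$, $\mathscr F'=L^2(\mathbb R;F')$ and $$\mathscr W=\{\varphi\in\mathscr F:\ \partial_t\varphi\in\mathscr F'\},\qquad \|\varphi\|_{\mathscr W}^2=\|\varphi\|_{\mathscr F}^2+\|\partial_t\varphi\|_{\mathscr F'}^2,$$ where $\partial_t\varphi$ is the distributional derivative of $\varphi$ as an $F'$-valued function of $t$. Inequalities between elements of $\mathscr H$ are meant $dt\otimes m$-a.e.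 For $\beta>0$ let $\mathscr A_\beta(\varphi,\psi)=\int_{\mathbb R}E^{(t)}(\varphi(t),\psi(t))\,dt+\beta(\varphi,\psi)_{\mathscr H}$ and $$\mathcal E_\beta(\varphi,\psi)=\begin{cases}-\int_{\mathbb R}(\partial_t\varphi,\psi)\,dt+\mathscr A_\beta(\varphi,\psi),&\varphi\in\mathscr W,\ \psi\in\mathscr F,\\ \int_{\mathbb R}(\partial_t\psi,\varphi)\,dt+\mathscr A_\beta(\varphi,\psi),&\varphi\in\mathscr F,\ \psi\in\mathscr W.\end{cases}$$ For $f\in\mathscr H$ let $G_\beta f\in\mathscr W$ be the solution of $\mathcal E_\beta(G_\beta f,\psi)=(f,\psi)_{\mathscr H}$ for all $\psi\in\mathscr F$. A function $\varphi\in\mathscr F$ is called $\alpha$-excessive if $\varphi\ge0$ and $nG_{n+\alpha}\varphi\le\varphi$ for all integers $n\ge0$. Let $\mathscr P_\alpha$ be the set of all $\varphi\in\mathscr F$ with $\mathcal E_\alpha(\varphi,\psi)\ge0$ for all nonnegative $\psi\in\mathscr W$, and $\mathscr L_g=\{\varphi\in\mathscr F:\varphi\ge g\}$. Let $\alpha>0$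 and let $g\in\mathscr W$ satisfy $|g|\le\varphi$ for some $\alpha$-excessive $\varphi\in\mathscr W$. For every $\epsilon>0$ there is a unique $g^\alpha_\epsilon\in\mathscr W$ such that, for every $u\in F$ and a.e. $t$, $$-\left(\partial_t g^\alpha_\epsilon(t),u\right)+E^{(t)}_\alpha(g^\alpha_\epsilon(t),u)=\frac1\epsilon\left((g^\alpha_\epsilon(t)-g(t))^-,u\right)_m .$$ Suppose that there is a constant $K$ with $\sup_{\epsilon>0}\frac1\epsilon\|(g^\alpha_\epsilon-g)^-\|_{\mathscr H}\le K\|g\|_{\mathscr H}$. Then, as $\epsilon\downarrow0$, $g^\alpha_\epsilon$ increases and converges to a function $e_g\in\mathscr W$, strongly in $\mathscr H$ and weakly both in $\mathscr F$ and in $\mathscr W$. Moreover $e_g\in\mathscr P_\alpha\cap\mathscr L_g\cap\mathscr W$, it satisfies $$\mathcal E_\alpha(e_g,e_g)\le\mathcal E_\alpha(e_g,\psi)\qquad\text{for all }\psi\in\mathscr L_g\cap\mathscr W,$$ and it is the minimal function of this class: $e_g\le v$ for every $v\in\mathscr P_\alpha\cap\mathscr L_g\cap\mathscr W$. -/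

import Mathlib

open MeasureTheory Filter Topology
open scoped ENNReal InnerProductSpace ContDiff

noncomputable section

/-- The space `H = L²(X; m)`. -/
abbrev L2Space {X : Type*} [MeasurableSpace X] (m : Measure X) : Type _ := Lp ℝ 2 m

/-- `(E, F)` is a symmetric Dirichlet form on `L²(X; m)`: a densely defined, symmetric,
nonnegative definite, closed (i.e. `F` is complete for `E₁ = E + (·,·)`) bilinear form on which
the unit contraction `u ↦ 0 ∨ (u ∧ 1)` operates. -/
structure IsDirichletForm {X : Type*} [MeasurableSpace X] (m : Measure X)
    (F : Submodule ℝ (L2Space m)) (E : F →ₗ[ℝ] F →ₗ[ℝ] ℝ) : Prop where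
  dense : Dense (F : Set (L2Space m))
  symm : ∀ u v, E u v = E v u
  nonneg : ∀ u, 0 ≤ E u u
  closed : ∀ u : ℕ → F,
    (∀ δ > 0, ∃ N, ∀ i ≥ N, ∀ j ≥ N,
      E (u i - u j) (u i - u j) + ‖((u i - u j : F) : L2Space m)‖ ^ 2 < δ) →
    ∃ v : F, Tendsto (fun i => E (u i - v) (u i - v) + ‖((u i - v : F) : L2Space m)‖ ^ 2)
      atTop (𝓝 0)
  markov : ∀ u : F, ∃ v : F,
    (∀ᵐ x ∂m, (v : L2Space m) x = max 0 (min ((u : L2Space m) x) 1)) ∧ E v v ≤ E u u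

/-- A family `(E^(t), F)`, `t ∈ ℝ`, of symmetric Dirichlet forms on `L²(X; m)` with common
domain `F`, measurable in `t`, with uniformly comparable `E₁^(t)`-norms, regular and local. -/
structure TimeDependentDirichletForm {X : Type*} [TopologicalSpace X] [MeasurableSpace X]
    (m : Measure X) where
  /-- the common domain `F` -/
  domain : Submodule ℝ (L2Space m)
  /-- the forms `E^(t)` -/
  E : ℝ → domain →ₗ[ℝ] domain →ₗ[ℝ] ℝ
  isDirichletForm : ∀ t, IsDirichletForm m domain (E t)
  measurable_form : ∀ u, Measurable fun t => E t u u
  comparable : ∃ c : ℝ, 0 < c ∧ ∀ t (u : domain),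
    c⁻¹ * (E 0 u u + ‖(u : L2Space m)‖ ^ 2) ≤ E t u u + ‖(u : L2Space m)‖ ^ 2 ∧
      E t u u + ‖(u : L2Space m)‖ ^ 2 ≤ c * (E 0 u u + ‖(u : L2Space m)‖ ^ 2)
  /-- `F ∩ C_c(X)` is dense in `F` for the norm of `F` -/
  regular_domain : ∀ u : domain, ∀ δ > 0, ∃ v : domain, ∃ f : X → ℝ,
    Continuous f ∧ HasCompactSupport f ∧ (v : L2Space m) =ᵐ[m] f ∧
      E 0 (u - v) (u - v) + ‖((u - v : domain) : L2Space m)‖ ^ 2 < δ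
  /-- `F ∩ C_c(X)` is uniformly dense in `C_c(X)` -/
  regular_continuous : ∀ f : X → ℝ, Continuous f → HasCompactSupport f → ∀ δ > 0,
    ∃ v : domain, ∃ f' : X → ℝ,
      Continuous f' ∧ HasCompactSupport f' ∧ (v : L2Space m) =ᵐ[m] f' ∧ ∀ x, |f x - f' x| < δ
  /-- `E^(t)(u,v) = 0` for functions with disjoint compact supports -/
  isLocal : ∀ t (u v : domain) (K L : Set X), IsCompact K → IsCompact L → Disjoint K L →
    (∀ᵐ x ∂m, x ∉ K → (u : L2Space m) x = 0) → (∀ᵐ x ∂m, x ∉ L → (v : L2Space m) x = 0) →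
    E t u v = 0

namespace TimeDependentDirichletForm

variable {X : Type*} [TopologicalSpace X] [MeasurableSpace X] {m : Measure X}

variable (D : TimeDependentDirichletForm m)

/-- The inner product `(u,v)_F = E^(0)(u,v) + (u,v)_m` on `F`. -/
@[reducible] def core : InnerProductSpace.Core ℝ D.domain where
  inner u v := D.E 0 u v + ⟪(u : L2Space m), (v : L2Space m)⟫_ℝ
  conj_inner_symm u v := by
    have h := (D.isDirichletForm 0).symm v u
    simp only [conj_trivial, real_inner_comm, h]
  re_inner_nonneg u := by
    have h := (D.isDirichletForm 0).nonneg u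
    have h' : 0 ≤ ⟪(u : L2Space m), (u : L2Space m)⟫_ℝ := real_inner_self_nonneg
    exact add_nonneg h h'
  add_left u v w := by
    simp only [map_add, LinearMap.add_apply, Submodule.coe_add, inner_add_left]; ring
  smul_left u v r := by
    simp only [map_smul, LinearMap.smul_apply, Submodule.coe_smul, inner_smul_left, smul_eq_mul,
      conj_trivial]
    ring
  definite u hu := by
    have h := (D.isDirichletForm 0).nonneg u
    have h' : 0 ≤ ⟪(u : L2Space m), (u : L2Space m)⟫_ℝ := real_inner_self_nonneg
    have h0 : ⟪(u : L2Space m), (u : L2Space m)⟫_ℝ = 0 := by linarith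
    exact Subtype.ext (inner_self_eq_zero.1 h0)

/-- The space `F`, normed by `‖u‖_F² = E₁^(0)(u,u)` (not by the `L²`-norm). -/
def FSpace (D : TimeDependentDirichletForm m) : Type _ := D.domain

instance : NormedAddCommGroup D.FSpace := D.core.toNormedAddCommGroup

instance : InnerProductSpace ℝ D.FSpace := InnerProductSpace.ofCore D.core.toCore

/-- The inclusion `F ⊆ H` as a linear map. -/
def inclₗ : D.FSpace →ₗ[ℝ] L2Space m := D.domain.subtype

/-- The form `E^(t)` on `F`. -/
def form (t : ℝ) : D.FSpace →ₗ[ℝ] D.FSpace →ₗ[ℝ] ℝ := D.E t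

theorem norm_sq_eq (u : D.FSpace) : ‖u‖ ^ 2 = D.form 0 u u + ‖D.inclₗ u‖ ^ 2 := by
  rw [← real_inner_self_eq_norm_sq, ← real_inner_self_eq_norm_sq]
  rfl

/-- The inclusion `F ⊆ H` as a continuous linear map. -/
def incl : D.FSpace →L[ℝ] L2Space m :=
  D.inclₗ.mkContinuous 1 fun u => by
    have h : 0 ≤ D.form 0 u u := (D.isDirichletForm 0).nonneg u
    have h' := D.norm_sq_eq u
    rw [one_mul]
    exact le_of_sq_le_sq (by linarith) (norm_nonneg u)

/-- The inclusion `F ⊆ H = H' ⊆ F'`: the functional `v ↦ (u,v)_m`. -/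
def pivot : D.FSpace →L[ℝ] StrongDual ℝ D.FSpace :=
  ((ContinuousLinearMap.compL ℝ D.FSpace (L2Space m) ℝ).flip D.incl).comp
    ((innerSL ℝ : L2Space m →L[ℝ] L2Space m →L[ℝ] ℝ).comp D.incl)

theorem pivot_apply (u v : D.FSpace) : D.pivot u v = ⟪D.incl u, D.incl v⟫_ℝ := rfl

end TimeDependentDirichletForm

/-- The space `𝓗 = L²(ℝ; H)`. Its order is the almost everywhere order: `f ≤ g` iff for a.e. `t`
one has `f(t,·) ≤ g(t,·)` `m`-a.e.; lattice operations (`|·|`, `(·)⁻`) are the pointwise ones. -/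
abbrev CalH {X : Type*} [MeasurableSpace X] (m : Measure X) : Type _ :=
  Lp (L2Space m) 2 (volume : Measure ℝ)

namespace TimeDependentDirichletForm

variable {X : Type*} [TopologicalSpace X] [MeasurableSpace X] {m : Measure X}
variable (D : TimeDependentDirichletForm m)

/-- The space `𝓕 = L²(ℝ; F)`. -/
abbrev CalF : Type _ := Lp D.FSpace 2 (volume : Measure ℝ)

/-- The space `𝓕' = L²(ℝ; F')`. -/
abbrev CalF' : Type _ := Lp (StrongDual ℝ D.FSpace) 2 (volume : Measure ℝ)

/-- The inclusion `𝓕 ⊆ 𝓗`. -/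
def toH : D.CalF →L[ℝ] CalH m := D.incl.compLpL 2 volume

/-- `η ∈ 𝓕'` is the distributional time derivative of `φ ∈ 𝓕`: as elements of `F'`,
`∫ η(t) ξ(t) dt = -∫ φ(t) ξ'(t) dt` for all test functions `ξ`. -/
def IsTimeDeriv (φ : D.CalF) (η : D.CalF') : Prop :=
  ∀ ξ : ℝ → ℝ, ContDiff ℝ ∞ ξ → HasCompactSupport ξ →
    ∫ t, ξ t • η t = -∫ t, deriv ξ t • D.pivot (φ t)

theorem integrable_smul_of_test {V : Type*} [NormedAddCommGroup V] [NormedSpace ℝ V]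
    {ξ : ℝ → ℝ} (hξ : Continuous ξ) (hc : HasCompactSupport ξ)
    {f : ℝ → V} (hf : MemLp f 2 volume) :
    Integrable fun t => ξ t • f t :=
  memLp_one_iff_integrable.1 (hf.smul (hξ.memLp_of_hasCompactSupport (p := 2) hc))

/-- The space of all `φ ∈ 𝓕` with `∂φ/∂t ∈ 𝓕'`, realised as the space of the pairs
`(φ, ∂φ/∂t)` with the norm `‖φ‖_𝓦² = ‖φ‖_𝓕² + ‖∂φ/∂t‖_𝓕'²`. -/
def graphW : Submodule ℝ (WithLp 2 (D.CalF × D.CalF')) where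
  carrier := {w | D.IsTimeDeriv w.fst w.snd}
  zero_mem' := by
    intro ξ _ _
    have h1 : ∫ t, ξ t • ((0 : D.CalF') : ℝ → _) t = 0 := by
      refine integral_eq_zero_of_ae ?_
      filter_upwards [Lp.coeFn_zero (StrongDual ℝ D.FSpace) 2 (volume : Measure ℝ)] with t ht
      rw [ht]; simp
    have h2 : ∫ t, deriv ξ t • D.pivot (((0 : D.CalF) : ℝ → _) t) = 0 := by
      refine integral_eq_zero_of_ae ?_
      filter_upwards [Lp.coeFn_zero D.FSpace 2 (volume : Measure ℝ)] with t ht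
      rw [ht]; simp
    change ∫ t, ξ t • ((0 : D.CalF') : ℝ → _) t
      = -∫ t, deriv ξ t • D.pivot (((0 : D.CalF) : ℝ → _) t)
    rw [h1, h2, neg_zero]
  add_mem' := by
    intro a b ha hb ξ hξ hc
    have hd : Continuous (deriv ξ) := hξ.continuous_deriv (by simp)
    have e1 : (fun t => ξ t • ((a.snd + b.snd : D.CalF') : ℝ → _) t)
        =ᵐ[volume] fun t => ξ t • a.snd t + ξ t • b.snd t := by
      filter_upwards [Lp.coeFn_add a.snd b.snd] with t ht
      rw [ht, Pi.add_apply, smul_add]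
    have e2 : (fun t => deriv ξ t • D.pivot (((a.fst + b.fst : D.CalF) : ℝ → _) t))
        =ᵐ[volume] fun t => deriv ξ t • D.pivot (a.fst t) + deriv ξ t • D.pivot (b.fst t) := by
      filter_upwards [Lp.coeFn_add a.fst b.fst] with t ht
      rw [ht, Pi.add_apply, map_add, smul_add]
    have i (c : D.CalF) : Integrable fun t => deriv ξ t • D.pivot (c t) :=
      integrable_smul_of_test hd hc.deriv (D.pivot.comp_memLp' (Lp.memLp c))
    change ∫ t, ξ t • ((a.snd + b.snd : D.CalF') : ℝ → _) t
      = -∫ t, deriv ξ t • D.pivot (((a.fst + b.fst : D.CalF) : ℝ → _) t)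
    rw [integral_congr_ae e1, integral_congr_ae e2,
      integral_add (integrable_smul_of_test hξ.continuous hc (Lp.memLp _))
        (integrable_smul_of_test hξ.continuous hc (Lp.memLp _)),
      integral_add (i a.fst) (i b.fst),
      ha ξ hξ hc, hb ξ hξ hc, neg_add]
  smul_mem' := by
    intro r a ha ξ hξ hc
    have e1 : (fun t => ξ t • ((r • a.snd : D.CalF') : ℝ → _) t)
        =ᵐ[volume] fun t => r • (ξ t • a.snd t) := by
      filter_upwards [Lp.coeFn_smul r a.snd] with t ht
      rw [ht, Pi.smul_apply, smul_comm]
    have e2 : (fun t => deriv ξ t • D.pivot (((r • a.fst : D.CalF) : ℝ → _) t))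
        =ᵐ[volume] fun t => r • (deriv ξ t • D.pivot (a.fst t)) := by
      filter_upwards [Lp.coeFn_smul r a.fst] with t ht
      rw [ht, Pi.smul_apply, map_smul, smul_comm]
    change ∫ t, ξ t • ((r • a.snd : D.CalF') : ℝ → _) t
      = -∫ t, deriv ξ t • D.pivot (((r • a.fst : D.CalF) : ℝ → _) t)
    rw [integral_congr_ae e1, integral_congr_ae e2, integral_smul, integral_smul,
      ha ξ hξ hc, smul_neg]

/-- The normed space `𝓦`. -/
abbrev CalW : Type _ := D.graphW

variable {D}

/-- `φ ∈ 𝓦` as an element of `𝓕`. -/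
def CalW.toF (φ : D.CalW) : D.CalF := φ.1.fst

/-- `∂φ/∂t ∈ 𝓕'` for `φ ∈ 𝓦`. -/
def CalW.timeDeriv (φ : D.CalW) : D.CalF' := φ.1.snd

variable (D)

/-- The pairing `⟨η, ψ⟩ = ∫ (η(t), ψ(t)) dt` of `𝓕'` and `𝓕`. -/
def pairing (η : D.CalF') (ψ : D.CalF) : ℝ := ∫ t, η t (ψ t)

/-- `𝓐_α(φ,ψ) = ∫ E^(t)(φ(t),ψ(t)) dt + α (φ,ψ)_𝓗`. -/
def formA (α : ℝ) (φ ψ : D.CalF) : ℝ :=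
  (∫ t, D.form t (φ t) (ψ t)) + α * ⟪D.toH φ, D.toH ψ⟫_ℝ

/-- `𝓔_α(φ,ψ) = -⟨∂φ/∂t, ψ⟩ + 𝓐_α(φ,ψ)` for `φ ∈ 𝓦`, `ψ ∈ 𝓕`. -/
def formWF (α : ℝ) (φ : D.CalW) (ψ : D.CalF) : ℝ :=
  -D.pairing φ.timeDeriv ψ + D.formA α φ.toF ψ

/-- `𝓔_α(φ,ψ) = ⟨∂ψ/∂t, φ⟩ + 𝓐_α(φ,ψ)` for `φ ∈ 𝓕`, `ψ ∈ 𝓦`. -/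
def formFW (α : ℝ) (φ : D.CalF) (ψ : D.CalW) : ℝ :=
  D.pairing ψ.timeDeriv φ + D.formA α φ ψ.toF

/-- `u = G_β f`, i.e. `u ∈ 𝓦` and `𝓔_β(u,ψ) = (f,ψ)_𝓗` for all `ψ ∈ 𝓕`. -/
def IsResolvent (β : ℝ) (f : CalH m) (u : D.CalW) : Prop :=
  ∀ ψ : D.CalF, D.formWF β u ψ = ⟪f, D.toH ψ⟫_ℝ

/-- The family `𝓟_α` of the `α`-potentials. -/
def potentials (α : ℝ) : Set D.CalF :=
  {φ | ∀ ψ : D.CalW, 0 ≤ D.toH ψ.toF → 0 ≤ D.formFW α φ ψ}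

/-- `φ` is `α`-excessive: `φ ≥ 0` and `n G_{n+α} φ ≤ φ` for all `n ≥ 0`. -/
def IsExcessive (α : ℝ) (φ : D.CalF) : Prop :=
  0 ≤ D.toH φ ∧
    ∀ (n : ℕ) (u : D.CalW), D.IsResolvent (n + α) (D.toH φ) u →
      (n : ℝ) • D.toH u.toF ≤ D.toH φ

/-- `𝓛_g = {φ ∈ 𝓕 : φ ≥ g a.e.}`. -/
def above (g : CalH m) : Set D.CalF := {φ | g ≤ D.toH φ}

/-- `u ∈ 𝓦` solves the penalised equation
`-(∂u/∂t, v) + E_α^(t)(u(t), v) = ε⁻¹ ((u(t) - g(t))⁻, v)` for every `v ∈ F`. -/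
def IsPenalized (α ε : ℝ) (g : CalH m) (u : D.CalW) : Prop :=
  ∀ v : D.FSpace, ∀ᵐ t : ℝ,
    -(u.timeDeriv t v) + (D.form t (u.toF t) v + α * ⟪D.incl (u.toF t), D.incl v⟫_ℝ)
      = ε⁻¹ * ⟪((D.toH u.toF - g)⁻ : CalH m) t, D.incl v⟫_ℝ

end TimeDependentDirichletForm

end

/-! Write `f_ε = ε⁻¹ (g_ε - g)⁻`, so that the penalised equation reads `g_ε = G_α f_ε`. Adding `ε⁻¹
g_ε` to both sides turns it into `g_ε = G_{α+1/ε} (ε⁻¹ (g_ε ∨ g))`, a fixed point equation for a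
contraction of `𝓗`; this gives existence, and the monotonicity of `x ↦ -x⁻` gives uniqueness.

The limit rests on a monotone operator argument. Subtracting the equations for two parameters and
testing with the difference of the solutions gives `⟪f_l - f_k, l f_l - k f_k⟫ ≤ 0`, as for Yosida
approximations. Hence `‖f_ε‖` increases as `ε ↓ 0`; it is bounded by hypothesis, and the same
inequality makes `f_ε` Cauchy (`exists_tendsto_of_inner_sub_nonpos`). With `f₀ = lim f_ε` and `e =
G_α f₀`, continuity of `G_α : 𝓗 → 𝓦` gives strong, hence weak, convergence in `𝓦`. Then `f₀ ≥ 0`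
makes `e` a potential, `(g_ε - g)⁻ = ε f_ε → 0` gives `e ≥ g`, and `(f₀, e - g) ≤ 0` gives the
variational inequality. Monotonicity in `ε` and minimality both come from the comparison principle
`le_of_supersolution`.

The parabolic tools need no chain rule: `⟨∂_t u, ψ⟩` is the derivative at `s = 0` of `(u(· + s),
ψ)`, so `⟨∂_t u, u⟩ = 0` and `⟨∂_t u, u⁻⟩ = 0` follow from Fermat's criterion for extrema. -/

noncomputable section

set_option linter.unusedSectionVars false

/-! ### Pointwise order in `L²`-spaces of lattice-valued functions. -/

section LpOrder

variable {α E : Type*} [MeasurableSpace α] {μ : Measure α} [NormedAddCommGroup E]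
  [InnerProductSpace ℝ E] [Lattice E] [HasSolidNorm E] [IsOrderedAddMonoid E]

theorem MeasureTheory.Lp.coeFn_posPart' (f : Lp E 2 μ) :
    ((f⁺ : Lp E 2 μ) : α → E) =ᵐ[μ] fun x => (f x)⁺ := by
  filter_upwards [Lp.coeFn_sup f 0, Lp.coeFn_zero E 2 μ] with x hx h0
  rw [posPart_def, hx, Pi.sup_apply, h0]
  rfl

theorem MeasureTheory.Lp.coeFn_negPart' (f : Lp E 2 μ) :
    ((f⁻ : Lp E 2 μ) : α → E) =ᵐ[μ] fun x => (f x)⁻ := by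
  filter_upwards [Lp.coeFn_sup (-f) 0, Lp.coeFn_zero E 2 μ, Lp.coeFn_neg f] with x hx h0 hn
  rw [negPart_def, hx, Pi.sup_apply, h0, hn]
  rfl

theorem MeasureTheory.Lp.inner_nonneg_of_pointwise
    (hE : ∀ a b : E, 0 ≤ a → 0 ≤ b → 0 ≤ ⟪a, b⟫_ℝ) (f g : Lp E 2 μ) (hf : 0 ≤ f) (hg : 0 ≤ g) :
    0 ≤ ⟪f, g⟫_ℝ := by
  rw [L2.inner_def]
  refine integral_nonneg_of_ae ?_
  filter_upwards [(Lp.coeFn_nonneg f).2 hf, (Lp.coeFn_nonneg g).2 hg] with x h1 h2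
  exact hE _ _ h1 h2

theorem MeasureTheory.Lp.inner_posPart_negPart_of_pointwise
    (hE : ∀ a : E, ⟪a⁺, a⁻⟫_ℝ = 0) (f : Lp E 2 μ) : ⟪f⁺, f⁻⟫_ℝ = 0 := by
  rw [L2.inner_def]
  refine integral_eq_zero_of_ae ?_
  filter_upwards [Lp.coeFn_posPart' f, Lp.coeFn_negPart' f] with x h1 h2
  rw [h1, h2, hE]
  rfl

end LpOrder

/-! ### Inner products compatible with the order. -/

section HilbertLattice

/-- The compatibility of the inner product with the order satisfied by `L²`-spaces. -/
class InnerLattice (E : Type*) [NormedAddCommGroup E] [InnerProductSpace ℝ E] [Lattice E] :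
    Prop where
  inner_nonneg : ∀ a b : E, 0 ≤ a → 0 ≤ b → 0 ≤ ⟪a, b⟫_ℝ
  inner_posPart_negPart : ∀ a : E, ⟪a⁺, a⁻⟫_ℝ = 0

instance : InnerLattice ℝ where
  inner_nonneg a b ha hb := by
    simpa using mul_nonneg hb ha
  inner_posPart_negPart a := by
    rcases le_total 0 a with h | h
    · simp [negPart_eq_zero.2 h]
    · simp [posPart_eq_zero.2 h]

instance {α E : Type*} [MeasurableSpace α] {μ : Measure α} [NormedAddCommGroup E]
    [InnerProductSpace ℝ E] [Lattice E] [HasSolidNorm E] [IsOrderedAddMonoid E]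
    [InnerLattice E] : InnerLattice (Lp E 2 μ) where
  inner_nonneg := Lp.inner_nonneg_of_pointwise InnerLattice.inner_nonneg
  inner_posPart_negPart := Lp.inner_posPart_negPart_of_pointwise InnerLattice.inner_posPart_negPart

variable {E : Type*} [NormedAddCommGroup E] [InnerProductSpace ℝ E] [Lattice E]
  [HasSolidNorm E] [IsOrderedAddMonoid E] [InnerLattice E]

namespace InnerLattice

theorem inner_self_negPart (a : E) : ⟪a, a⁻⟫_ℝ = -‖a⁻‖ ^ 2 := by
  nth_rw 1 [← posPart_sub_negPart a]
  rw [inner_sub_left, inner_posPart_negPart, real_inner_self_eq_norm_sq, zero_sub]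

theorem nonneg_of_inner_negPart_nonneg {a : E} (h : 0 ≤ ⟪a, a⁻⟫_ℝ) : 0 ≤ a := by
  rw [inner_self_negPart] at h
  have h0 : ‖a⁻‖ = 0 := by nlinarith [norm_nonneg a⁻]
  exact negPart_eq_zero.1 (norm_eq_zero.1 h0)

theorem nonneg_of_forall_inner {a : E} (h : ∀ b : E, 0 ≤ b → 0 ≤ ⟪a, b⟫_ℝ) : 0 ≤ a :=
  nonneg_of_inner_negPart_nonneg (h _ (negPart_nonneg a))

theorem smul_nonneg' {r : ℝ} (hr : 0 ≤ r) {a : E} (ha : 0 ≤ a) : 0 ≤ r • a :=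
  nonneg_of_forall_inner fun b hb => by
    rw [real_inner_smul_left]
    exact mul_nonneg hr (inner_nonneg _ _ ha hb)

/-- In `a - b = (a⁺ - b⁺) + (b⁻ - a⁻)` the second summand contributes a square and the first only
nonnegative cross terms, since positive and negative parts are orthogonal. This is the monotonicity
of `x ↦ -x⁻`. -/
theorem negPart_inner_mono_nonneg (a b : E) : 0 ≤ ⟪b⁻ - a⁻, a - b⟫_ℝ := by
  have h1 := inner_nonneg a⁺ b⁻ (posPart_nonneg a) (negPart_nonneg b)
  have h2 := inner_nonneg b⁺ a⁻ (posPart_nonneg b) (negPart_nonneg a)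
  have ha := inner_posPart_negPart a
  have hb := inner_posPart_negPart b
  have h3 : 0 ≤ ⟪b⁻ - a⁻, b⁻ - a⁻⟫_ℝ := real_inner_self_nonneg
  have h4 : a - b = (a⁺ - b⁺) + (b⁻ - a⁻) := by
    conv_lhs => rw [← posPart_sub_negPart a, ← posPart_sub_negPart b]
    abel
  rw [h4, inner_add_right]
  have h5 : ⟪b⁻ - a⁻, a⁺ - b⁺⟫_ℝ = ⟪a⁺, b⁻⟫_ℝ - ⟪b⁺, b⁻⟫_ℝ - ⟪a⁺, a⁻⟫_ℝ + ⟪b⁺, a⁻⟫_ℝ := by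
    simp only [inner_sub_left, inner_sub_right, real_inner_comm]
    ring
  linarith

end InnerLattice

end HilbertLattice

/-! ### Abstract Hilbert space tools. -/

section Hilbert

/-- A bounded sequence of a Hilbert space whose image under an injective continuous linear map
converges is weakly convergent. -/
theorem exists_weakLimit_of_tendsto_image {V W : Type*} [NormedAddCommGroup V]
    [InnerProductSpace ℝ V] [CompleteSpace V] [NormedAddCommGroup W] [InnerProductSpace ℝ W]
    (J : V →L[ℝ] W) (hJ : Function.Injective J) {x : ℕ → V} {C : ℝ} (hC : ∀ n, ‖x n‖ ≤ C)
    {y : W} (hy : Tendsto (fun n => J (x n)) atTop (𝓝 y)) :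
    ∃ v : V, J v = y ∧ ∀ l : StrongDual ℝ V, Tendsto (fun n => l (x n)) atTop (𝓝 (l v)) := by
  -- Banach–Alaoglu gives a weak limit along each ultrafilter; its image under `J` is always `y`, so
  -- by injectivity the limit does not depend on the ultrafilter.
  have key : ∀ 𝒰 : Ultrafilter ℕ, (𝒰 : Filter ℕ) ≤ atTop → ∃ v : V, J v = y ∧
      ∀ l : StrongDual ℝ V, Tendsto (fun n => l (x n)) 𝒰 (𝓝 (l v)) := by
    intro 𝒰 h𝒰
    let ξ : ℕ → WeakDual ℝ V := fun n =>
      StrongDual.toWeakDual (InnerProductSpace.toDual ℝ V (x n))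
    have hmem : ∀ n, ξ n ∈ (WeakDual.toStrongDual ⁻¹' Metric.closedBall (0 : StrongDual ℝ V) C) := by
      intro n
      simp only [Set.mem_preimage, mem_closedBall_zero_iff, ξ]
      change ‖InnerProductSpace.toDual ℝ V (x n)‖ ≤ C
      rw [LinearIsometryEquiv.norm_map]
      exact hC n
    obtain ⟨w, -, hw⟩ := (WeakDual.isCompact_closedBall (𝕜 := ℝ) (E := V) 0 C).ultrafilter_le_nhds
      (𝒰.map ξ) (by
        rw [le_principal_iff]
        exact Filter.mem_map.2 (Filter.univ_mem' hmem))
    have hw' : Tendsto ξ 𝒰 (𝓝 w) := hw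
    let v : V := (InnerProductSpace.toDual ℝ V).symm (WeakDual.toStrongDual w)
    have hv : ∀ l : StrongDual ℝ V, Tendsto (fun n => l (x n)) 𝒰 (𝓝 (l v)) := by
      intro l
      have h := ((WeakDual.eval_continuous ((InnerProductSpace.toDual ℝ V).symm l)).tendsto w).comp
        hw'
      have e : l v = w ((InnerProductSpace.toDual ℝ V).symm l) := by
        rw [← InnerProductSpace.toDual_symm_apply (𝕜 := ℝ) (x := v) (y := l), real_inner_comm,
          InnerProductSpace.toDual_symm_apply]
        rfl
      rw [e]
      refine h.congr fun n => ?_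
      change ⟪x n, (InnerProductSpace.toDual ℝ V).symm l⟫_ℝ = _
      rw [real_inner_comm, InnerProductSpace.toDual_symm_apply]
    refine ⟨v, ?_, hv⟩
    refine ext_inner_left ℝ fun z => ?_
    have h1 := hv ((innerSL ℝ z).comp J)
    have h2 := ((innerSL ℝ z).continuous.tendsto y).comp (hy.mono_left h𝒰)
    exact tendsto_nhds_unique h1 h2
  obtain ⟨v, hv, -⟩ := key (Ultrafilter.of atTop) (Ultrafilter.of_le _)
  refine ⟨v, hv, fun l => (tendsto_iff_ultrafilter _ _ _).2 fun 𝒰 h𝒰 => ?_⟩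
  obtain ⟨v', hv', h⟩ := key 𝒰 h𝒰
  rw [hJ (hv.trans hv'.symm)]
  exact h l

/-- A bounded family with `⟪F λ - F μ, λ F λ - μ F μ⟫ ≤ 0` converges as `λ ↓ 0`. -/
theorem exists_tendsto_of_inner_sub_nonpos {V : Type*} [NormedAddCommGroup V]
    [InnerProductSpace ℝ V] [CompleteSpace V] {F : ℝ → V} {C : ℝ} (hC : ∀ l > 0, ‖F l‖ ≤ C)
    (hF : ∀ l > 0, ∀ k > 0, ⟪F l - F k, l • F l - k • F k⟫_ℝ ≤ 0) :
    ∃ f, Tendsto F (𝓝[>] 0) (𝓝 f) := by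
  -- Expanding the hypothesis gives `(l + k)‖F l - F k‖² ≤ (k - l)(‖F l‖² - ‖F k‖²)`, and `k - l ≤ l
  -- + k`. So the squared norms are antitone, and their bounded monotone limit controls the
  -- increments of `F`.
  have key : ∀ l > 0, ∀ k ≥ l, ‖F l - F k‖ ^ 2 ≤ ‖F l‖ ^ 2 - ‖F k‖ ^ 2 := by
    intro l hl k hk
    have hk0 : 0 < k := hl.trans_le hk
    have h := hF l hl k hk0
    have e : ‖F l - F k‖ ^ 2 = ‖F l‖ ^ 2 - 2 * ⟪F l, F k⟫_ℝ + ‖F k‖ ^ 2 := norm_sub_sq_real _ _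
    have e2 : ⟪F l - F k, l • F l - k • F k⟫_ℝ
        = l * ‖F l‖ ^ 2 - (l + k) * ⟪F l, F k⟫_ℝ + k * ‖F k‖ ^ 2 := by
      simp only [inner_sub_left, inner_sub_right, real_inner_smul_right,
        real_inner_self_eq_norm_sq, real_inner_comm (F l) (F k)]
      ring
    have h1 : (l + k) * ‖F l - F k‖ ^ 2 ≤ (k - l) * (‖F l‖ ^ 2 - ‖F k‖ ^ 2) := by
      rw [e]; rw [e2] at h; linarith
    have h2 : 0 ≤ (k - l) * (‖F l‖ ^ 2 - ‖F k‖ ^ 2) :=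
      le_trans (by positivity) h1
    rcases hk.eq_or_lt with h3 | h3
    · rw [h3]; simp
    · have h4 : 0 ≤ ‖F l‖ ^ 2 - ‖F k‖ ^ 2 := nonneg_of_mul_nonneg_right h2 (by linarith)
      have h5 : (l + k) * ‖F l - F k‖ ^ 2 ≤ (l + k) * (‖F l‖ ^ 2 - ‖F k‖ ^ 2) := by
        refine h1.trans ?_
        exact mul_le_mul_of_nonneg_right (by linarith) h4
      exact le_of_mul_le_mul_left h5 (by linarith)
  have hanti : AntitoneOn (fun l => ‖F l‖ ^ 2) (Set.Ioi 0) := fun l hl k _ hlk => by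
    have := key l hl k hlk
    have := sq_nonneg ‖F l - F k‖
    dsimp only
    linarith
  have hb : BddAbove ((fun l => ‖F l‖ ^ 2) '' Set.Ioi 0) := by
    refine ⟨C ^ 2, ?_⟩
    rintro _ ⟨l, hl, rfl⟩
    exact pow_le_pow_left₀ (norm_nonneg _) (hC l hl) 2
  have hlim := hanti.tendsto_nhdsGT hb
  have hcau : Cauchy (map (fun l => ‖F l‖ ^ 2) (𝓝[>] 0)) := hlim.cauchy_map
  have hcau' : Cauchy (map F (𝓝[>] 0)) := by
    rw [Metric.cauchy_iff] at hcau ⊢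
    refine ⟨inferInstance, fun δ hδ => ?_⟩
    obtain ⟨t, ht, htd⟩ := hcau.2 (δ ^ 2) (by positivity)
    refine ⟨F '' ((fun l => ‖F l‖ ^ 2) ⁻¹' t ∩ Set.Ioi 0),
      image_mem_map (inter_mem ht self_mem_nhdsWithin), ?_⟩
    rintro _ ⟨l, ⟨hlt, hl⟩, rfl⟩ _ ⟨k, ⟨hkt, hk⟩, rfl⟩
    have hd := htd _ hlt _ hkt
    rw [Real.dist_eq] at hd
    rw [dist_eq_norm]
    refine lt_of_pow_lt_pow_left₀ 2 hδ.le (lt_of_le_of_lt ?_ hd)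
    rcases le_total l k with h | h
    · exact (key l hl k h).trans (le_abs_self _)
    · rw [norm_sub_rev, abs_sub_comm]
      exact (key k hk l h).trans (le_abs_self _)
  exact cauchy_map_iff_exists_tendsto.1 hcau'

/-- Lions' projection theorem. -/
theorem exists_forall_inner_eq_of_coercive {V W : Type*} [AddCommGroup W] [Module ℝ W]
    [NormedAddCommGroup V] [InnerProductSpace ℝ V] [CompleteSpace V] (i L : W →ₗ[ℝ] V)
    (hi : Function.Injective i) {c : ℝ} (hc : 0 < c) (h : ∀ w, c * ‖i w‖ ^ 2 ≤ ⟪L w, i w⟫_ℝ)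
    (l : StrongDual ℝ V) : ∃ v : V, ∀ w, ⟪v, L w⟫_ℝ = l (i w) := by
  have hb : ∀ w, c * ‖i w‖ ≤ ‖L w‖ := by
    intro w
    rcases (norm_nonneg (i w)).eq_or_lt with h0 | h0
    · rw [← h0, mul_zero]; exact norm_nonneg _
    · have := (h w).trans (real_inner_le_norm _ _)
      exact le_of_mul_le_mul_right (by linarith) h0
  have hL : Function.Injective L := by
    rw [injective_iff_map_eq_zero]
    intro w hw
    have := hb w
    rw [hw, norm_zero] at this
    have h1 : ‖i w‖ = 0 := by nlinarith [norm_nonneg (i w)]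
    exact (injective_iff_map_eq_zero i).1 hi w (norm_eq_zero.1 h1)
  let e := LinearEquiv.ofInjective L hL
  -- By `hb` the assignment `L w ↦ l (i w)` is bounded on the range of `L`. Hahn–Banach extends it
  -- to `V`, and Riesz represents the extension.
  let l₀ : StrongDual ℝ (LinearMap.range L) :=
    LinearMap.mkContinuous ((l : V →ₗ[ℝ] ℝ) ∘ₗ i ∘ₗ (e.symm : LinearMap.range L →ₗ[ℝ] W))
      (‖l‖ * c⁻¹) (by
        intro y
        obtain ⟨w, rfl⟩ := e.surjective y
        have h1 : ‖(e w : LinearMap.range L)‖ = ‖L w‖ := rfl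
        simp only [LinearMap.comp_apply, LinearEquiv.coe_coe, LinearEquiv.symm_apply_apply,
          ContinuousLinearMap.coe_coe]
        rw [h1, mul_assoc]
        refine (l.le_opNorm _).trans (mul_le_mul_of_nonneg_left ?_ (norm_nonneg _))
        rw [inv_mul_eq_div, le_div_iff₀ hc, mul_comm]
        exact hb w)
  obtain ⟨l₁, hl₁, -⟩ := exists_extension_norm_eq _ l₀
  refine ⟨(InnerProductSpace.toDual ℝ V).symm l₁, fun w => ?_⟩
  rw [InnerProductSpace.toDual_symm_apply]
  have := hl₁ (e w)
  change l₁ (L w) = _ at this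
  rw [this]
  simp [l₀]

end Hilbert

/-! ### The domain `F` as a Hilbert space, and positive parts in it. -/

namespace TimeDependentDirichletForm

variable {X : Type*} [TopologicalSpace X] [MeasurableSpace X] {m : Measure X}
variable (D : TimeDependentDirichletForm m)

section Domain

theorem incl_injective : Function.Injective D.incl := Subtype.val_injective

theorem norm_sq (u : D.FSpace) : ‖u‖ ^ 2 = D.form 0 u u + ‖D.incl u‖ ^ 2 := D.norm_sq_eq u

theorem form_nonneg (t : ℝ) (u : D.FSpace) : 0 ≤ D.form t u u := (D.isDirichletForm t).nonneg u

theorem form_symm (t : ℝ) (u v : D.FSpace) : D.form t u v = D.form t v u :=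
  (D.isDirichletForm t).symm u v

instance : CompleteSpace D.FSpace := by
  refine Metric.complete_of_cauchySeq_tendsto fun u hu => ?_
  have hn : ∀ x : D.FSpace, D.E 0 x x + ‖D.incl x‖ ^ 2 = ‖x‖ ^ 2 :=
    fun x => (D.norm_sq x).symm
  obtain ⟨v, hv⟩ : ∃ v : D.FSpace,
      Tendsto (fun i => D.E 0 (u i - v) (u i - v) + ‖D.incl (u i - v)‖ ^ 2) atTop (𝓝 0) :=
    (D.isDirichletForm 0).closed u (by
    intro δ hδ
    obtain ⟨N, hN⟩ := Metric.cauchySeq_iff.1 hu (Real.sqrt δ) (Real.sqrt_pos.2 hδ)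
    refine ⟨N, fun i hi j hj => ?_⟩
    have h := hN i hi j hj
    rw [dist_eq_norm] at h
    refine lt_of_eq_of_lt (hn (u i - u j)) ?_
    exact (Real.lt_sqrt (norm_nonneg _)).1 h)
  refine ⟨v, tendsto_iff_norm_sub_tendsto_zero.2 ?_⟩
  have h1 : Tendsto (fun i => ‖u i - v‖ ^ 2) atTop (𝓝 0) :=
    hv.congr fun i => hn (u i - v)
  have h2 := h1.sqrt
  rw [Real.sqrt_zero] at h2
  exact h2.congr fun i => Real.sqrt_sq (norm_nonneg _)

/-- The constant of comparison of the norms `E₁^(t)`. -/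
def cst : ℝ := D.comparable.choose

theorem cst_pos : 0 < D.cst := D.comparable.choose_spec.1

theorem le_form_add (t : ℝ) (u : D.FSpace) :
    D.cst⁻¹ * ‖u‖ ^ 2 ≤ D.form t u u + ‖D.incl u‖ ^ 2 := by
  rw [D.norm_sq]
  exact (D.comparable.choose_spec.2 t u).1

theorem form_add_le (t : ℝ) (u : D.FSpace) :
    D.form t u u + ‖D.incl u‖ ^ 2 ≤ D.cst * ‖u‖ ^ 2 := by
  rw [D.norm_sq]
  exact (D.comparable.choose_spec.2 t u).2

theorem form_self_le (t : ℝ) (u : D.FSpace) : D.form t u u ≤ D.cst * ‖u‖ ^ 2 :=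
  le_trans (by have := sq_nonneg ‖D.incl u‖; linarith) (D.form_add_le t u)

theorem form_sq_le (t : ℝ) (u v : D.FSpace) :
    D.form t u v ^ 2 ≤ D.form t u u * D.form t v v := by
  have h := LinearMap.BilinForm.apply_mul_apply_le_of_forall_zero_le (D.form t) (D.form_nonneg t) u v
  rwa [D.form_symm t v u, ← sq] at h

theorem abs_form_le (t : ℝ) (u v : D.FSpace) : |D.form t u v| ≤ D.cst * ‖u‖ * ‖v‖ := by
  have hc := D.cst_pos
  refine abs_le_of_sq_le_sq ?_ (by positivity)
  refine (D.form_sq_le t u v).trans ?_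
  calc _ ≤ (D.cst * ‖u‖ ^ 2) * (D.cst * ‖v‖ ^ 2) :=
        mul_le_mul (D.form_self_le t u) (D.form_self_le t v) (D.form_nonneg t v) (by positivity)
    _ = _ := by ring

/-- The form `E^(t)` as a continuous bilinear form on `F`. -/
def formL (t : ℝ) : D.FSpace →L[ℝ] D.FSpace →L[ℝ] ℝ :=
  (D.form t).mkContinuous₂ D.cst fun u v => D.abs_form_le t u v

theorem measurable_form_apply (u v : D.FSpace) : Measurable fun t => D.form t u v := by
  have h : ∀ t, D.form t u v
      = (D.form t (u + v) (u + v) - D.form t u u - D.form t v v) / 2 := by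
    intro t
    simp only [map_add, LinearMap.add_apply, D.form_symm t v u]
    ring
  simp only [h]
  have hm : ∀ w : D.FSpace, Measurable fun t => D.form t w w := fun w => D.measurable_form w
  exact (((hm _).sub (hm _)).sub (hm _)).div_const 2

theorem aestronglyMeasurable_form {f g : ℝ → D.FSpace} {μ : Measure ℝ}
    (hf : AEStronglyMeasurable f μ) (hg : AEStronglyMeasurable g μ) :
    AEStronglyMeasurable (fun t => D.form t (f t) (g t)) μ := by
  obtain ⟨f', hf', hff⟩ := hf
  obtain ⟨g', hg', hgg⟩ := hg
  refine ⟨fun t => D.form t (f' t) (g' t), ?_, by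
    filter_upwards [hff, hgg] with t h1 h2; rw [h1, h2]⟩
  refine Measurable.stronglyMeasurable ?_
  refine measurable_of_tendsto_metrizable
    (f := fun n t => D.form t (hf'.approx n t) (hg'.approx n t)) (fun n => ?_) ?_
  · exact SimpleFunc.measurable_bind ((hf'.approx n).pair (hg'.approx n))
      (fun p t => D.form t p.1 p.2) fun p => D.measurable_form_apply p.1 p.2
  · refine tendsto_pi_nhds.2 fun t => ?_
    have h : Continuous fun p : D.FSpace × D.FSpace => D.formL t p.1 p.2 := by fun_prop
    exact (h.tendsto (f' t, g' t)).comp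
      ((hf'.tendsto_approx t).prodMk_nhds (hg'.tendsto_approx t))

/-- Scaling: the unit contraction is applied to `u / r` and the result multiplied by `r`. -/
theorem exists_truncation (t : ℝ) (u : D.FSpace) {r : ℝ} (hr : 0 < r) :
    ∃ v : D.FSpace, (∀ᵐ x ∂m, D.incl v x = max 0 (min (D.incl u x) r)) ∧
      D.form t v v ≤ D.form t u u := by
  obtain ⟨w, hw, hle⟩ : ∃ w : D.FSpace,
      (∀ᵐ x ∂m, D.incl w x = max 0 (min (D.incl (r⁻¹ • u) x) 1)) ∧
        D.form t w w ≤ D.form t (r⁻¹ • u) (r⁻¹ • u) :=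
    (D.isDirichletForm t).markov (r⁻¹ • u : D.FSpace)
  refine ⟨r • w, ?_, ?_⟩
  · rw [map_smul] at hw ⊢
    filter_upwards [hw, Lp.coeFn_smul r (D.incl w), Lp.coeFn_smul r⁻¹ (D.incl u)] with x a b c
    rw [b, Pi.smul_apply]
    rw [a, c, Pi.smul_apply, smul_eq_mul, smul_eq_mul, mul_max_of_nonneg _ _ hr.le,
      mul_min_of_nonneg _ _ hr.le, mul_inv_cancel_left₀ hr.ne', mul_zero, mul_one]
  · simp only [map_smul, LinearMap.smul_apply, smul_eq_mul] at hle ⊢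
    calc _ ≤ r * (r * (r⁻¹ * (r⁻¹ * D.form t u u))) := by gcongr
      _ = _ := by field_simp

theorem abs_max_zero_min_le {a r : ℝ} : |max 0 (min a r)| ≤ |a| := by
  rw [abs_of_nonneg (le_max_left _ _)]
  exact max_le (abs_nonneg _) ((min_le_left _ _).trans (le_abs_self _))

theorem tendsto_truncation {f : L2Space m} {v : ℕ → L2Space m}
    (hv : ∀ n : ℕ, ∀ᵐ x ∂m, v n x = max 0 (min (f x) (n + 1))) :
    Tendsto v atTop (𝓝 f⁺) := by
  rw [tendsto_iff_norm_sub_tendsto_zero]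
  have h1 : Tendsto (fun n => ‖v n - f⁺‖ ^ 2) atTop (𝓝 0) := by
    have e : ∀ n, ‖v n - f⁺‖ ^ 2 = ∫ x, (max 0 (min (f x) (n + 1)) - max 0 (f x)) ^ 2 ∂m := by
      intro n
      rw [← real_inner_self_eq_norm_sq, L2.inner_def]
      refine integral_congr_ae ?_
      filter_upwards [hv n, Lp.coeFn_sub (v n) f⁺, Lp.coeFn_posPart' f] with x h1 h2 h3
      rw [h2, Pi.sub_apply, h1, h3, posPart_def, sup_comm (f x) 0, real_inner_self_eq_norm_sq,
        Real.norm_eq_abs, sq_abs]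
    simp only [e]
    rw [show 𝓝 (0 : ℝ) = 𝓝 (∫ _ : X, (0 : ℝ) ∂m) by rw [integral_zero]]
    refine tendsto_integral_of_dominated_convergence (fun x => f x ^ 2) ?_ ?_ ?_ ?_
    · intro n
      have := Lp.aestronglyMeasurable f
      exact ((((aestronglyMeasurable_const (b := (0 : ℝ))).sup
        (this.inf (aestronglyMeasurable_const (b := ((n : ℝ) + 1))))).sub
        ((aestronglyMeasurable_const (b := (0 : ℝ))).sup this)).pow 2)
    · exact (Lp.memLp f).integrable_sq
    · intro n
      refine Eventually.of_forall fun x => ?_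
      rw [Real.norm_eq_abs, abs_of_nonneg (sq_nonneg _)]
      rw [sq_le_sq]
      have hn : (0 : ℝ) < n + 1 := by positivity
      rcases le_total (f x) 0 with h | h
      · rw [min_eq_left (by linarith), sub_self, abs_zero]; exact abs_nonneg _
      · rw [max_eq_right h, max_eq_right (le_min h hn.le), abs_sub_comm,
          abs_of_nonneg (sub_nonneg.2 (min_le_left _ _)), abs_of_nonneg h]
        linarith [le_min h hn.le]
    · refine Eventually.of_forall fun x => ?_
      refine tendsto_const_nhds.congr' ?_
      filter_upwards [eventually_ge_atTop ⌈f x⌉₊] with n hn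
      have : f x ≤ n + 1 := (Nat.le_ceil _).trans (by exact_mod_cast hn.trans (Nat.le_succ n))
      rw [min_eq_left this, sub_self]
      norm_num
  have h2 := h1.sqrt
  rw [Real.sqrt_zero] at h2
  exact h2.congr fun i => Real.sqrt_sq (norm_nonneg _)

/-- The truncations of `u` at height `n + 1` stay bounded in `F` and converge to `u⁺` in `H`, so
they converge weakly in `F`; the energy bound passes to the weak limit. -/
theorem exists_posPart (t : ℝ) (u : D.FSpace) :
    ∃ p : D.FSpace, D.incl p = (D.incl u)⁺ ∧ D.form t p p ≤ D.form t u u := by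
  have hn : ∀ n : ℕ, (0 : ℝ) < n + 1 := fun n => by positivity
  choose x hx hxt using fun n : ℕ => D.exists_truncation t u (hn n)
  have hc := D.cst_pos
  have hb : ∀ n, ‖x n‖ ≤ Real.sqrt (D.cst * (D.form t u u + ‖D.incl u‖ ^ 2)) := by
    intro n
    refine Real.le_sqrt_of_sq_le ?_
    have h1 := D.le_form_add t (x n)
    rw [inv_mul_le_iff₀ hc] at h1
    refine h1.trans ?_
    have h2 : ‖D.incl (x n)‖ ≤ ‖D.incl u‖ := by
      refine Lp.norm_le_norm_of_ae_le ?_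
      filter_upwards [hx n] with y hy
      rw [hy]
      exact abs_max_zero_min_le
    gcongr
    exact hxt n
  obtain ⟨p, hp, hlim⟩ := exists_weakLimit_of_tendsto_image D.incl D.incl_injective hb
    (tendsto_truncation hx)
  refine ⟨p, hp, ?_⟩
  have h1 := hlim (D.formL t p)
  -- Lower semicontinuity through Cauchy–Schwarz: `E(p, xₙ)² ≤ E(p, p) E(u, u)`, and the left side
  -- tends to `E(p, p)²`.
  have h2 : D.form t p p ^ 2 ≤ D.form t p p * D.form t u u := by
    refine le_of_tendsto (h1.pow 2) (Eventually.of_forall fun n => ?_)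
    refine (D.form_sq_le t p (x n)).trans ?_
    exact mul_le_mul_of_nonneg_left (hxt n) (D.form_nonneg t p)
  rcases (D.form_nonneg t p).eq_or_lt with h0 | h0
  · rw [← h0]; exact D.form_nonneg t u
  · rw [sq] at h2
    exact le_of_mul_le_mul_left h2 h0

/-- The positive part `u ↦ u⁺` on `F`. -/
def posF (u : D.FSpace) : D.FSpace := (D.exists_posPart 0 u).choose

theorem incl_posF (u : D.FSpace) : D.incl (D.posF u) = (D.incl u)⁺ :=
  (D.exists_posPart 0 u).choose_spec.1

theorem posF_eq {u p : D.FSpace} (h : D.incl p = (D.incl u)⁺) : D.posF u = p :=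
  D.incl_injective ((D.incl_posF u).trans h.symm)

/-- `posF` is chosen using `t = 0`, but an element of `F` is determined by its image in `H`, so the
same element serves for every `t`. -/
theorem form_posF_le (t : ℝ) (u : D.FSpace) :
    D.form t (D.posF u) (D.posF u) ≤ D.form t u u := by
  obtain ⟨p, hp, h⟩ := D.exists_posPart t u
  rwa [D.posF_eq hp]

theorem norm_posPart_le (f : L2Space m) : ‖f⁺‖ ≤ ‖f‖ := by
  refine norm_le_norm_of_abs_le_abs ?_
  rw [abs_of_nonneg (posPart_nonneg f)]
  exact sup_le (le_abs_self f) (abs_nonneg f)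

theorem norm_posF_le (u : D.FSpace) : ‖D.posF u‖ ≤ ‖u‖ := by
  refine le_of_sq_le_sq ?_ (norm_nonneg _)
  rw [D.norm_sq, D.norm_sq, D.incl_posF]
  have := norm_posPart_le (D.incl u)
  gcongr
  exact D.form_posF_le 0 u

theorem posPart_posPart_sub_smul_negPart (f : L2Space m) {s : ℝ} (hs : 0 < s) :
    (f⁺ - s • (f⁺ - f))⁺ = f⁺ := by
  refine Lp.ext ?_
  filter_upwards [Lp.coeFn_posPart' (f⁺ - s • (f⁺ - f)), Lp.coeFn_posPart' f,
    Lp.coeFn_sub f⁺ (s • (f⁺ - f)), Lp.coeFn_smul s (f⁺ - f), Lp.coeFn_sub f⁺ f]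
    with x h1 h2 h3 h4 h5
  rw [h1, h3, Pi.sub_apply, h4, Pi.smul_apply, h5, Pi.sub_apply, h2, smul_eq_mul]
  rcases le_total 0 (f x) with h | h
  · rw [posPart_eq_self.2 h, sub_self, mul_zero, sub_zero, posPart_eq_self.2 h]
  · rw [posPart_eq_zero.2 h, posPart_eq_zero]
    nlinarith

/-- This is `E(u⁺, u⁻) ≤ 0`, by a first variation: `u⁺` is the positive part of `u⁺ - s u⁻` for
every `s > 0`, so it has no more energy than that function. Divide by `s` and let `s ↓ 0`. -/
theorem form_posF_posF_sub_nonpos (t : ℝ) (u : D.FSpace) :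
    D.form t (D.posF u) (D.posF u - u) ≤ 0 := by
  set p := D.posF u with hp
  set q := p - u with hq
  have h : ∀ s > 0, 2 * D.form t p q ≤ s * D.form t q q := by
    intro s hs
    have h1 : D.posF (p - s • q) = p := by
      refine D.posF_eq ?_
      rw [map_sub, map_smul, hq, map_sub, hp, D.incl_posF,
        posPart_posPart_sub_smul_negPart _ hs]
    have h2 := D.form_posF_le t (p - s • q)
    rw [h1] at h2
    simp only [map_sub, LinearMap.sub_apply, map_smul, LinearMap.smul_apply, smul_eq_mul,
      D.form_symm t q p] at h2
    have h3 : 0 ≤ s * (s * D.form t q q - 2 * D.form t p q) := by linarith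
    have := nonneg_of_mul_nonneg_right h3 hs
    linarith
  have hlim : Tendsto (fun s : ℝ => s * D.form t q q) (𝓝[>] 0) (𝓝 (0 * D.form t q q)) :=
    ((continuous_id.mul continuous_const).tendsto 0).mono_left nhdsWithin_le_nhds
  have h4 := ge_of_tendsto hlim (eventually_nhdsWithin_of_forall fun s hs => h s hs)
  linarith

end Domain

end TimeDependentDirichletForm

/-! ### Elementary tensors `ξ(t) v` in `L²(ℝ; V)`. -/

section Tensor

variable {V : Type*} [NormedAddCommGroup V]

theorem integral_norm_mul_norm_le {V' : Type*} [NormedAddCommGroup V']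
    (f : Lp V 2 (volume : Measure ℝ)) (g : Lp V' 2 (volume : Measure ℝ)) :
    ∫ t, ‖f t‖ * ‖g t‖ ≤ ‖f‖ * ‖g‖ := by
  let f' := MemLp.toLp _ (Lp.memLp f).norm
  let g' := MemLp.toLp _ (Lp.memLp g).norm
  have e : ∫ t, ‖f t‖ * ‖g t‖ = ⟪f', g'⟫_ℝ := by
    rw [L2.inner_def]
    refine integral_congr_ae ?_
    filter_upwards [(Lp.memLp f).norm.coeFn_toLp, (Lp.memLp g).norm.coeFn_toLp] with t h1 h2
    rw [h1, h2, real_inner_comm]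
    rfl
  have hf : ‖f'‖ = ‖f‖ := by
    rw [Lp.norm_toLp, eLpNorm_norm, Lp.norm_def]
  have hg : ‖g'‖ = ‖g‖ := by
    rw [Lp.norm_toLp, eLpNorm_norm, Lp.norm_def]
  rw [e, ← hf, ← hg]
  exact real_inner_le_norm _ _

theorem integrable_norm_mul_norm {V' : Type*} [NormedAddCommGroup V']
    (f : Lp V 2 (volume : Measure ℝ)) (g : Lp V' 2 (volume : Measure ℝ)) :
    Integrable fun t => ‖f t‖ * ‖g t‖ :=
  (Lp.memLp f).norm.integrable_mul (Lp.memLp g).norm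

variable [NormedSpace ℝ V]

/-- The function `t ↦ ξ(t) v`. -/
def tens (v : V) : Lp ℝ 2 (volume : Measure ℝ) →L[ℝ] Lp V 2 (volume : Measure ℝ) :=
  (ContinuousLinearMap.toSpanSingleton ℝ v).compLpL 2 volume

theorem coeFn_tens (v : V) (ξ : Lp ℝ 2 (volume : Measure ℝ)) :
    tens v ξ =ᵐ[volume] fun t => ξ t • v := by
  filter_upwards [ContinuousLinearMap.coeFn_compLpL
    (ContinuousLinearMap.toSpanSingleton ℝ v) ξ] with t ht
  exact ht

/-- A test function as an element of `L²(ℝ)`. -/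
def testLp (ξ : ℝ → ℝ) (hξ : Continuous ξ) (hc : HasCompactSupport ξ) :
    Lp ℝ 2 (volume : Measure ℝ) :=
  (hξ.memLp_of_hasCompactSupport (p := 2) hc).toLp ξ

theorem coeFn_tens_testLp (v : V) (ξ : ℝ → ℝ) (hξ : Continuous ξ) (hc : HasCompactSupport ξ) :
    tens v (testLp ξ hξ hc) =ᵐ[volume] fun t => ξ t • v := by
  filter_upwards [coeFn_tens v (testLp ξ hξ hc),
    (hξ.memLp_of_hasCompactSupport (p := 2) hc).coeFn_toLp] with t h1 h2
  rw [h1, testLp, h2]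

/-- Density of test functions in `L²(ℝ)` extends the vanishing to all `ξ ∈ L²(ℝ)`, in particular to
indicators, hence to simple functions, which are dense. -/
theorem eq_zero_of_forall_tens (l : StrongDual ℝ (Lp V 2 (volume : Measure ℝ)))
    (h : ∀ (v : V) (ξ : ℝ → ℝ) (hξ : ContDiff ℝ ∞ ξ) (hc : HasCompactSupport ξ),
      l (tens v (testLp ξ hξ.continuous hc)) = 0) : l = 0 := by
  have h1 : ∀ (v : V) (ξ : Lp ℝ 2 (volume : Measure ℝ)), l (tens v ξ) = 0 := by
    intro v
    have hd := Lp.dense_hasCompactSupport_contDiff (F := ℝ) (p := 2) (μ := (volume : Measure ℝ))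
      (by simp)
    have hcl : IsClosed {ξ : Lp ℝ 2 (volume : Measure ℝ) | l (tens v ξ) = 0} :=
      isClosed_eq (by fun_prop) continuous_const
    intro ξ
    refine hcl.closure_subset_iff.2 ?_ (hd ξ)
    rintro ξ ⟨g, hg, hc, hs⟩
    have e : ξ = testLp g hs.continuous hc := by
      refine Lp.ext (hg.trans (MemLp.coeFn_toLp _).symm)
    rw [Set.mem_ofPred_eq, e]
    exact h v g hs hc
  ext ψ
  refine Lp.induction (by simp) (motive := fun ψ => l ψ = (0 : StrongDual ℝ _) ψ) ?_ ?_ ?_ ψ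
  · intro c s hs hμ
    have := h1 c (indicatorConstLp 2 hs hμ.ne (1 : ℝ))
    rw [zero_apply, ← this]
    congr 1
    rw [Lp.simpleFunc.coe_indicatorConst]
    refine Lp.ext ?_
    filter_upwards [coeFn_tens c (indicatorConstLp 2 hs hμ.ne (1 : ℝ)),
      indicatorConstLp_coeFn (p := 2) (hs := hs) (hμs := hμ.ne) (c := c),
      indicatorConstLp_coeFn (p := 2) (hs := hs) (hμs := hμ.ne) (c := (1 : ℝ))] with t h1 h2 h3
    rw [h1, h2, h3]
    by_cases ht : t ∈ s <;> simp [ht]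
  · intro f g hf hg _ h1 h2
    rw [map_add, h1, h2]
    simp
  · exact isClosed_eq (by fun_prop) (by fun_prop)

end Tensor

theorem span_tens_dense {V : Type*} [NormedAddCommGroup V] [InnerProductSpace ℝ V]
    [CompleteSpace V] :
    (Submodule.span ℝ {ψ : Lp V 2 (volume : Measure ℝ) | ∃ (v : V) (ξ : ℝ → ℝ)
      (hξ : ContDiff ℝ ∞ ξ) (hc : HasCompactSupport ξ),
        ψ = tens v (testLp ξ hξ.continuous hc)}).topologicalClosure = ⊤ := by
  rw [Submodule.topologicalClosure_eq_top_iff, Submodule.eq_bot_iff]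
  intro x hx
  have h : innerSL ℝ x = 0 := eq_zero_of_forall_tens _ fun v ξ hξ hc => by
    rw [innerSL_apply_apply]
    exact (Submodule.mem_orthogonal' _ _).1 hx _ (Submodule.subset_span ⟨v, ξ, hξ, hc, rfl⟩)
  have h2 := congrArg (fun l => l x) h
  simpa using h2

/-! ### The spaces `𝓕`, `𝓕'` and the form `𝓐_α`. -/

namespace TimeDependentDirichletForm

variable {X : Type*} [TopologicalSpace X] [MeasurableSpace X] {m : Measure X}
variable (D : TimeDependentDirichletForm m)

section CalF

theorem coeFn_toH (φ : D.CalF) : D.toH φ =ᵐ[volume] fun t => D.incl (φ t) :=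
  ContinuousLinearMap.coeFn_compLpL _ _

theorem toH_injective : Function.Injective D.toH := by
  intro φ ψ h
  refine Lp.ext ?_
  filter_upwards [D.coeFn_toH φ, D.coeFn_toH ψ] with t h1 h2
  rw [h] at h1
  exact D.incl_injective (h1.symm.trans h2)

theorem inner_toH (φ : D.CalF) (f : CalH m) : ⟪f, D.toH φ⟫_ℝ = ∫ t, ⟪f t, D.incl (φ t)⟫_ℝ := by
  rw [L2.inner_def]
  refine integral_congr_ae ?_
  filter_upwards [D.coeFn_toH φ] with t h
  rw [h]

theorem integrable_form (φ ψ : D.CalF) : Integrable fun t => D.form t (φ t) (ψ t) := by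
  refine ((integrable_norm_mul_norm φ ψ).const_mul D.cst).mono'
    (D.aestronglyMeasurable_form (Lp.aestronglyMeasurable φ) (Lp.aestronglyMeasurable ψ)) ?_
  refine Eventually.of_forall fun t => ?_
  rw [Real.norm_eq_abs, ← mul_assoc]
  exact D.abs_form_le t _ _

/-- `∫ E^(t)(φ(t),ψ(t)) dt` as a continuous bilinear form on `𝓕`. -/
def formI : D.CalF →L[ℝ] D.CalF →L[ℝ] ℝ :=
  (LinearMap.mk₂ ℝ (fun φ ψ : D.CalF => ∫ t, D.form t (φ t) (ψ t))
    (fun φ φ' ψ => by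
      rw [← integral_add (D.integrable_form φ ψ) (D.integrable_form φ' ψ)]
      refine integral_congr_ae ?_
      filter_upwards [Lp.coeFn_add φ φ'] with t h
      rw [h, Pi.add_apply, map_add, LinearMap.add_apply])
    (fun r φ ψ => by
      rw [← integral_smul]
      refine integral_congr_ae ?_
      filter_upwards [Lp.coeFn_smul r φ] with t h
      rw [h, Pi.smul_apply, map_smul, LinearMap.smul_apply])
    (fun φ ψ ψ' => by
      rw [← integral_add (D.integrable_form φ ψ) (D.integrable_form φ ψ')]
      refine integral_congr_ae ?_
      filter_upwards [Lp.coeFn_add ψ ψ'] with t h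
      rw [h, Pi.add_apply, map_add])
    (fun r φ ψ => by
      rw [← integral_smul]
      refine integral_congr_ae ?_
      filter_upwards [Lp.coeFn_smul r ψ] with t h
      rw [h, Pi.smul_apply, map_smul])).mkContinuous₂ D.cst (fun φ ψ => by
    have h := D.cst_pos
    rw [LinearMap.mk₂_apply, mul_assoc]
    calc ‖∫ t, D.form t (φ t) (ψ t)‖ ≤ ∫ t, D.cst * (‖φ t‖ * ‖ψ t‖) := by
          refine norm_integral_le_of_norm_le ((integrable_norm_mul_norm φ ψ).const_mul D.cst) ?_
          refine Eventually.of_forall fun t => ?_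
          rw [Real.norm_eq_abs, ← mul_assoc]
          exact D.abs_form_le t _ _
      _ = D.cst * ∫ t, ‖φ t‖ * ‖ψ t‖ := integral_const_mul _ _
      _ ≤ _ := mul_le_mul_of_nonneg_left (integral_norm_mul_norm_le φ ψ) h.le)

/-- The operator on `𝓕` that represents `𝓐_α`. -/
def opA (α : ℝ) : D.CalF →L[ℝ] D.CalF :=
  InnerProductSpace.continuousLinearMapOfBilin D.formI
    + α • (ContinuousLinearMap.adjoint D.toH).comp D.toH

theorem inner_opA (α : ℝ) (φ ψ : D.CalF) : ⟪D.opA α φ, ψ⟫_ℝ = D.formA α φ ψ := by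
  rw [opA, add_apply, inner_add_left, smul_apply,
    real_inner_smul_left, ContinuousLinearMap.comp_apply,
    ContinuousLinearMap.adjoint_inner_left,
    InnerProductSpace.continuousLinearMapOfBilin_apply]
  rfl

theorem formA_symm (α : ℝ) (φ ψ : D.CalF) : D.formA α φ ψ = D.formA α ψ φ := by
  simp only [formA, D.form_symm _ (φ _), real_inner_comm]

theorem norm_sq_calF (φ : D.CalF) : ‖φ‖ ^ 2 = ∫ t, ‖φ t‖ ^ 2 := by
  rw [← real_inner_self_eq_norm_sq, L2.inner_def]
  simp only [real_inner_self_eq_norm_sq]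

theorem norm_sq_toH (φ : D.CalF) : ‖D.toH φ‖ ^ 2 = ∫ t, ‖D.incl (φ t)‖ ^ 2 := by
  rw [← real_inner_self_eq_norm_sq, L2.inner_def]
  refine integral_congr_ae ?_
  filter_upwards [D.coeFn_toH φ] with t h
  rw [h, real_inner_self_eq_norm_sq]

theorem formI_self_nonneg (φ : D.CalF) : 0 ≤ ∫ t, D.form t (φ t) (φ t) :=
  integral_nonneg fun t => D.form_nonneg t _

theorem le_formA (α : ℝ) (φ : D.CalF) : α * ‖D.toH φ‖ ^ 2 ≤ D.formA α φ φ := by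
  rw [formA, real_inner_self_eq_norm_sq]
  have := D.formI_self_nonneg φ
  linarith

/-- `E + α ≥ min(1, α) (E + 1)`, and `E + 1` dominates `cst⁻¹ ‖·‖²` at every time. -/
theorem formA_coercive {α : ℝ} (hα : 0 < α) (φ : D.CalF) :
    min 1 α * D.cst⁻¹ * ‖φ‖ ^ 2 ≤ D.formA α φ φ := by
  have hi : Integrable fun t => ‖D.incl (φ t)‖ ^ 2 := by
    have := (L2.integrable_inner (𝕜 := ℝ) (D.toH φ) (D.toH φ))
    refine this.congr ?_
    filter_upwards [D.coeFn_toH φ] with t h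
    rw [h, real_inner_self_eq_norm_sq]
  have h1 : D.cst⁻¹ * ‖φ‖ ^ 2 ≤ (∫ t, D.form t (φ t) (φ t)) + ‖D.toH φ‖ ^ 2 := by
    rw [D.norm_sq_calF, D.norm_sq_toH, ← integral_add (D.integrable_form φ φ) hi,
      ← integral_const_mul]
    refine integral_mono ?_ ((D.integrable_form φ φ).add hi) fun t => D.le_form_add t (φ t)
    refine Integrable.const_mul ?_ _
    have := (L2.integrable_inner (𝕜 := ℝ) φ φ)
    simpa only [real_inner_self_eq_norm_sq] using this
  have h2 := D.formI_self_nonneg φ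
  have h3 : 0 ≤ ‖D.toH φ‖ ^ 2 := sq_nonneg _
  have h4 : 0 < min 1 α := lt_min one_pos hα
  rw [formA, real_inner_self_eq_norm_sq, mul_assoc]
  calc _ ≤ min 1 α * ((∫ t, D.form t (φ t) (φ t)) + ‖D.toH φ‖ ^ 2) :=
        mul_le_mul_of_nonneg_left h1 h4.le
    _ ≤ _ := by
        rw [mul_add]
        exact add_le_add (mul_le_of_le_one_left h2 (min_le_left _ _))
          (mul_le_mul_of_nonneg_right (min_le_right _ _) h3)

/-- The Riesz isomorphism of `F` and `F'`. -/
def riesz : D.FSpace ≃L[ℝ] StrongDual ℝ D.FSpace where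
  toFun := InnerProductSpace.toDual ℝ D.FSpace
  invFun := (InnerProductSpace.toDual ℝ D.FSpace).symm
  left_inv := (InnerProductSpace.toDual ℝ D.FSpace).left_inv
  right_inv := (InnerProductSpace.toDual ℝ D.FSpace).right_inv
  map_add' := map_add _
  map_smul' r u := (InnerProductSpace.toDual ℝ D.FSpace).map_smulₛₗ r u
  continuous_toFun := (InnerProductSpace.toDual ℝ D.FSpace).continuous
  continuous_invFun := (InnerProductSpace.toDual ℝ D.FSpace).symm.continuous

theorem riesz_apply (u v : D.FSpace) : D.riesz u v = ⟪u, v⟫_ℝ := rfl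

theorem inner_riesz_symm (η : StrongDual ℝ D.FSpace) (v : D.FSpace) :
    ⟪D.riesz.symm η, v⟫_ℝ = η v := by
  rw [← riesz_apply, ContinuousLinearEquiv.apply_symm_apply]

/-- The Riesz map `𝓕 → 𝓕'`. -/
def rieszL : D.CalF →L[ℝ] D.CalF' := (D.riesz : D.FSpace →L[ℝ] StrongDual ℝ D.FSpace).compLpL 2 volume

/-- The Riesz map `𝓕' → 𝓕`. -/
def rieszInvL : D.CalF' →L[ℝ] D.CalF :=
  (D.riesz.symm : StrongDual ℝ D.FSpace →L[ℝ] D.FSpace).compLpL 2 volume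

theorem rieszL_rieszInvL (η : D.CalF') : D.rieszL (D.rieszInvL η) = η := by
  refine Lp.ext ?_
  filter_upwards [ContinuousLinearMap.coeFn_compLpL (D.riesz : D.FSpace →L[ℝ] StrongDual ℝ D.FSpace) (D.rieszInvL η),
    ContinuousLinearMap.coeFn_compLpL
      (D.riesz.symm : StrongDual ℝ D.FSpace →L[ℝ] D.FSpace) η] with t h1 h2
  rw [rieszL, h1, rieszInvL, h2]
  simp

theorem rieszInvL_rieszL (φ : D.CalF) : D.rieszInvL (D.rieszL φ) = φ := by
  refine Lp.ext ?_
  filter_upwards [ContinuousLinearMap.coeFn_compLpL (D.riesz : D.FSpace →L[ℝ] StrongDual ℝ D.FSpace) φ,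
    ContinuousLinearMap.coeFn_compLpL
      (D.riesz.symm : StrongDual ℝ D.FSpace →L[ℝ] D.FSpace) (D.rieszL φ)] with t h1 h2
  rw [rieszInvL, h2, rieszL, h1]
  simp

theorem pairing_eq_inner (η : D.CalF') (ψ : D.CalF) : D.pairing η ψ = ⟪D.rieszInvL η, ψ⟫_ℝ := by
  rw [pairing, L2.inner_def]
  refine integral_congr_ae ?_
  filter_upwards [ContinuousLinearMap.coeFn_compLpL
      (D.riesz.symm : StrongDual ℝ D.FSpace →L[ℝ] D.FSpace) η] with t h
  rw [rieszInvL, h]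
  exact (D.inner_riesz_symm _ _).symm

/-- Measurability of `t ↦ u(t)⁺` into `F` is not evident, so `u` is approximated by simple
functions. Their positive parts are bounded in `𝓕` and converge in `𝓗`, and a weak limit in `𝓕` is
the desired element. -/
theorem exists_toH_eq_posPart (u : D.CalF) : ∃ p : D.CalF, D.toH p = (D.toH u)⁺ := by
  have hd : Dense (Set.range ((↑) : Lp.simpleFunc D.FSpace 2 (volume : Measure ℝ) → D.CalF)) :=
    Lp.simpleFunc.denseRange (by simp)
  obtain ⟨s', hs', hlim⟩ := mem_closure_iff_seq_limit.1 (hd u)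
  choose s hs using hs'
  have hm : ∀ n, MemLp (fun t => D.posF (Lp.simpleFunc.toSimpleFunc (s n) t)) 2 volume := by
    intro n
    refine (Lp.simpleFunc.memLp (s n)).mono
      ((Lp.simpleFunc.toSimpleFunc (s n)).map D.posF).aestronglyMeasurable ?_
    exact Eventually.of_forall fun t => D.norm_posF_le _
  let p : ℕ → D.CalF := fun n => (hm n).toLp
  have hp : ∀ n, p n =ᵐ[volume] fun t => D.posF (s' n t) := by
    intro n
    filter_upwards [(hm n).coeFn_toLp, Lp.simpleFunc.toSimpleFunc_eq_toFun (s n)] with t h1 h2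
    rw [h1, h2, hs]
  obtain ⟨C, hC⟩ := (Metric.isBounded_range_of_tendsto s' hlim).exists_norm_le
  have hb : ∀ n, ‖p n‖ ≤ C := by
    intro n
    refine le_trans (Lp.norm_le_norm_of_ae_le ?_) (hC (s' n) ⟨n, rfl⟩)
    filter_upwards [hp n] with t h
    rw [h]
    exact D.norm_posF_le _
  have hJ : ∀ n, D.toH (p n) = (D.toH (s' n))⁺ := by
    intro n
    refine Lp.ext ?_
    filter_upwards [hp n, D.coeFn_toH (p n), D.coeFn_toH (s' n),
      Lp.coeFn_posPart' (D.toH (s' n))] with t h1 h2 h3 h4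
    rw [h2, h4, h3, h1, D.incl_posF]
  have hcont : Continuous fun f : CalH m => f⁺ := by
    simp only [posPart_def]
    exact continuous_id.sup continuous_const
  obtain ⟨q, hq, -⟩ := exists_weakLimit_of_tendsto_image D.toH D.toH_injective hb
    (y := (D.toH u)⁺) (by
      simp only [hJ]
      exact (hcont.tendsto _).comp ((D.toH.continuous.tendsto u).comp hlim))
  exact ⟨q, hq⟩

theorem exists_toH_eq_negPart (u : D.CalF) : ∃ n : D.CalF, D.toH n = (D.toH u)⁻ := by
  obtain ⟨p, hp⟩ := D.exists_toH_eq_posPart (-u)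
  exact ⟨p, by rw [hp, map_neg, posPart_neg]⟩

/-- With `w = w⁺ - w⁻` one has `E(w, w⁻) = E(w⁺, w⁻) - E(w⁻, w⁻) ≤ 0` at each time, while `(w, w⁻) =
-‖w⁻‖²`. -/
theorem formA_negPart_le (α : ℝ) {w n : D.CalF} (hn : D.toH n = (D.toH w)⁻) :
    D.formA α w n ≤ -(α * ‖D.toH n‖ ^ 2) := by
  have hpt : ∀ᵐ t, n t = D.posF (w t) - w t := by
    filter_upwards [D.coeFn_toH n, D.coeFn_toH w, Lp.coeFn_negPart' (D.toH w)] with t h1 h2 h3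
    refine D.incl_injective ?_
    rw [← h1, hn, h3, h2, map_sub, D.incl_posF]
    exact eq_sub_of_add_eq' (sub_eq_iff_eq_add.1 (posPart_sub_negPart (D.incl (w t)))).symm
  have h1 : ∫ t, D.form t (w t) (n t) ≤ 0 := by
    refine integral_nonpos_of_ae ?_
    filter_upwards [hpt] with t ht
    have h2 := D.form_posF_posF_sub_nonpos t (w t)
    have h3 := D.form_nonneg t (n t)
    have h4 : w t = D.posF (w t) - n t := by rw [ht]; abel
    rw [← ht] at h2
    rw [h4, map_sub, LinearMap.sub_apply]
    exact sub_nonpos.2 (h2.trans h3)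
  have h2 : ⟪D.toH w, D.toH n⟫_ℝ = -‖D.toH n‖ ^ 2 := by
    rw [hn]; exact InnerLattice.inner_self_negPart _
  rw [formA, h2]
  linarith

end CalF

end TimeDependentDirichletForm

/-! ### Translations in time. -/

section Shift

variable {V : Type*} [NormedAddCommGroup V]

/-- The translation `f ↦ f(· + s)`. -/
def shift [NormedSpace ℝ V] (s : ℝ) :
    Lp V 2 (volume : Measure ℝ) →ₗᵢ[ℝ] Lp V 2 (volume : Measure ℝ) :=
  Lp.compMeasurePreservingₗᵢ ℝ (· + s) (measurePreserving_add_right volume s)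

theorem coeFn_shift [NormedSpace ℝ V] (s : ℝ) (f : Lp V 2 (volume : Measure ℝ)) :
    shift s f =ᵐ[volume] fun t => f (t + s) :=
  Lp.coeFn_compMeasurePreserving f (measurePreserving_add_right volume s)

theorem ae_shift {p : ℝ → Prop} (s : ℝ) (h : ∀ᵐ t, p t) : ∀ᵐ t, p (t + s) :=
  (measurePreserving_add_right (volume : Measure ℝ) s).quasiMeasurePreserving.ae h

theorem shift_zero [NormedSpace ℝ V] (f : Lp V 2 (volume : Measure ℝ)) : shift 0 f = f := by
  refine Lp.ext ?_
  filter_upwards [coeFn_shift 0 f] with t h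
  rw [h, add_zero]

theorem inner_shift [InnerProductSpace ℝ V] (s : ℝ) (f g : Lp V 2 (volume : Measure ℝ)) :
    ⟪shift s f, g⟫_ℝ = ⟪f, shift (-s) g⟫_ℝ := by
  have h : shift s (shift (-s) g) = g := by
    refine Lp.ext ?_
    filter_upwards [coeFn_shift s (shift (-s) g), ae_shift s (coeFn_shift (-s) g)] with t h1 h2
    rw [h1, h2, add_neg_cancel_right]
  conv_lhs => rw [← h]
  exact LinearIsometry.inner_map_map (𝕜 := ℝ) (E := Lp V 2 (volume : Measure ℝ))
    (E' := Lp V 2 (volume : Measure ℝ)) (shift s) f (shift (-s) g)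

theorem shift_nonneg [InnerProductSpace ℝ V] [Lattice V] [HasSolidNorm V] [IsOrderedAddMonoid V]
    (s : ℝ) {f : Lp V 2 (volume : Measure ℝ)} (hf : 0 ≤ f) : 0 ≤ shift s f := by
  rw [← Lp.coeFn_nonneg] at hf ⊢
  filter_upwards [coeFn_shift s f, ae_shift s hf] with t h1 h2
  rw [h1]
  exact h2

/-- The translate of a test function has the negative derivative in the translation parameter. -/
theorem hasDerivAt_integral_mul_translate {p : ℝ → ℝ} (hp : LocallyIntegrable p) {ξ : ℝ → ℝ}
    (hξ : ContDiff ℝ ∞ ξ) (hc : HasCompactSupport ξ) (s : ℝ) :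
    HasDerivAt (fun s => ∫ t, p t * ξ (t - s)) (-∫ t, p t * deriv ξ (t - s)) s := by
  -- The function of `s` is the convolution of `p` with the reflection of `ξ`; the minus sign comes
  -- from differentiating the reflection.
  have hg : ContDiff ℝ 1 fun x => ξ (-x) := (hξ.of_le (by simp)).comp contDiff_neg
  have hcg : HasCompactSupport fun x => ξ (-x) :=
    hc.comp_homeomorph (Homeomorph.neg ℝ)
  have h := hcg.hasDerivAt_convolution_right (ContinuousLinearMap.mul ℝ ℝ) hp hg s
  have hd : deriv (fun x => ξ (-x)) = fun x => -deriv ξ (-x) := by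
    funext x
    exact deriv_comp_neg ξ x
  rw [hd] at h
  have e1 : (fun s => ∫ t, p t * ξ (t - s))
      = convolution p (fun x => ξ (-x)) (ContinuousLinearMap.mul ℝ ℝ) := by
    funext s
    rw [convolution_def]
    simp only [ContinuousLinearMap.mul_apply', neg_sub]
  have e2 : -∫ t, p t * deriv ξ (t - s)
      = convolution p (fun x => -deriv ξ (-x)) (ContinuousLinearMap.mul ℝ ℝ) volume s := by
    rw [convolution_def, ← integral_neg]
    simp only [ContinuousLinearMap.mul_apply', neg_sub, mul_neg]
  rw [e1, e2]
  exact h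

theorem translate_test {ξ : ℝ → ℝ} (hξ : ContDiff ℝ ∞ ξ) (hc : HasCompactSupport ξ) (s : ℝ) :
    ContDiff ℝ ∞ (fun t => ξ (t - s)) ∧ HasCompactSupport fun t => ξ (t - s) :=
  ⟨hξ.comp (contDiff_id.sub contDiff_const), hc.comp_homeomorph (Homeomorph.subRight s)⟩

theorem shift_tens [NormedSpace ℝ V] (s : ℝ) (v : V) {ξ : ℝ → ℝ} (hξ : ContDiff ℝ ∞ ξ)
    (hc : HasCompactSupport ξ) :
    shift (-s) (tens v (testLp ξ hξ.continuous hc))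
      = tens v (testLp _ (translate_test hξ hc s).1.continuous (translate_test hξ hc s).2) := by
  refine Lp.ext ?_
  filter_upwards [coeFn_shift (-s) (tens v (testLp ξ hξ.continuous hc)),
    ae_shift (-s) (coeFn_tens_testLp v ξ hξ.continuous hc),
    coeFn_tens_testLp v _ (translate_test hξ hc s).1.continuous (translate_test hξ hc s).2]
    with t h1 h2 h3
  rw [h1, h2, h3, sub_eq_add_neg]

end Shift

/-! ### The time derivative as the derivative of translations. -/

namespace TimeDependentDirichletForm

variable {X : Type*} [TopologicalSpace X] [MeasurableSpace X] {m : Measure X}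
variable (D : TimeDependentDirichletForm m)

section TimeDeriv

theorem toH_shift (s : ℝ) (φ : D.CalF) : D.toH (shift s φ) = shift s (D.toH φ) := by
  refine Lp.ext ?_
  filter_upwards [D.coeFn_toH (shift s φ), coeFn_shift s φ, coeFn_shift s (D.toH φ),
    ae_shift s (D.coeFn_toH φ)] with t h1 h2 h3 h4
  rw [h1, h2, h3, h4]

theorem inner_toH_tens (u : D.CalF) (v : D.FSpace) (ξ : ℝ → ℝ) (hξ : Continuous ξ)
    (hc : HasCompactSupport ξ) :
    ⟪D.toH u, D.toH (tens v (testLp ξ hξ hc))⟫_ℝ = ∫ t, D.pivot (u t) v * ξ t := by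
  rw [inner_toH]
  refine integral_congr_ae ?_
  filter_upwards [coeFn_tens_testLp v ξ hξ hc, D.coeFn_toH u] with t h1 h2
  rw [h1, h2, map_smul, real_inner_smul_right, pivot_apply, mul_comm]

theorem pairing_tens (η : D.CalF') (v : D.FSpace) (ξ : ℝ → ℝ) (hξ : Continuous ξ)
    (hc : HasCompactSupport ξ) :
    D.pairing η (tens v (testLp ξ hξ hc)) = ∫ t, η t v * ξ t := by
  refine integral_congr_ae ?_
  filter_upwards [coeFn_tens_testLp v ξ hξ hc] with t h1
  rw [h1, map_smul, smul_eq_mul, mul_comm]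

/-- The `F'`-valued integrals commute with evaluation at `v ∈ F`, so the distributional derivative
can be tested on tensors `ξ(t) v`. -/
theorem isTimeDeriv_iff (u : D.CalF) (η : D.CalF') :
    D.IsTimeDeriv u η ↔ ∀ (v : D.FSpace) (ξ : ℝ → ℝ) (hξ : ContDiff ℝ ∞ ξ)
      (hc : HasCompactSupport ξ), D.pairing η (tens v (testLp ξ hξ.continuous hc))
        = -⟪D.toH u, D.toH (tens v (testLp (deriv ξ) (hξ.continuous_deriv (by simp)) hc.deriv))⟫_ℝ
      := by
  have key : ∀ (v : D.FSpace) (ξ : ℝ → ℝ) (hξ : ContDiff ℝ ∞ ξ) (hc : HasCompactSupport ξ),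
      (∫ t, ξ t • η t) v = D.pairing η (tens v (testLp ξ hξ.continuous hc)) ∧
      (-∫ t, deriv ξ t • D.pivot (u t)) v = -⟪D.toH u, D.toH (tens v
        (testLp (deriv ξ) (hξ.continuous_deriv (by simp)) hc.deriv))⟫_ℝ := by
    intro v ξ hξ hc
    have hd : Continuous (deriv ξ) := hξ.continuous_deriv (by simp)
    have hi : Integrable fun t => deriv ξ t • D.pivot (u t) :=
      integrable_smul_of_test hd hc.deriv (D.pivot.comp_memLp' (Lp.memLp u))
    rw [pairing_tens, inner_toH_tens, neg_apply,
      ContinuousLinearMap.integral_apply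
        (integrable_smul_of_test hξ.continuous hc (Lp.memLp η)),
      ContinuousLinearMap.integral_apply hi]
    simp only [smul_apply, smul_eq_mul, mul_comm, and_self]
  constructor
  · intro h v ξ hξ hc
    rw [← (key v ξ hξ hc).1, ← (key v ξ hξ hc).2, h ξ hξ hc]
  · intro h ξ hξ hc
    ext v
    rw [(key v ξ hξ hc).1, (key v ξ hξ hc).2, h v ξ hξ hc]

/-- The inclusion `𝓦 ⊆ 𝓕`. -/
def toFL : D.CalW →L[ℝ] D.CalF :=
  (ContinuousLinearMap.fst ℝ D.CalF D.CalF').comp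
    ((WithLp.prodContinuousLinearEquiv 2 ℝ D.CalF D.CalF' :
      WithLp 2 (D.CalF × D.CalF') →L[ℝ] D.CalF × D.CalF').comp D.graphW.subtypeL)

/-- The time derivative `𝓦 → 𝓕'`. -/
def derivL : D.CalW →L[ℝ] D.CalF' :=
  (ContinuousLinearMap.snd ℝ D.CalF D.CalF').comp
    ((WithLp.prodContinuousLinearEquiv 2 ℝ D.CalF D.CalF' :
      WithLp 2 (D.CalF × D.CalF') →L[ℝ] D.CalF × D.CalF').comp D.graphW.subtypeL)

theorem toFL_apply (u : D.CalW) : D.toFL u = u.toF := rfl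

theorem derivL_apply (u : D.CalW) : D.derivL u = u.timeDeriv := rfl

/-- The element of `𝓦` given by a function and its time derivative. -/
def mkW (u : D.CalF) (η : D.CalF') (h : D.IsTimeDeriv u η) : D.CalW := ⟨WithLp.toLp 2 (u, η), h⟩

theorem mkW_toF (u : D.CalF) (η : D.CalF') (h : D.IsTimeDeriv u η) : (D.mkW u η h).toF = u := rfl

theorem mkW_timeDeriv (u : D.CalF) (η : D.CalF') (h : D.IsTimeDeriv u η) :
    (D.mkW u η h).timeDeriv = η := rfl

theorem ext_rieszInvL {η η' : D.CalF'} (h : D.rieszInvL η = D.rieszInvL η') : η = η' := by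
  rw [← D.rieszL_rieszInvL η, h, D.rieszL_rieszInvL]

variable {D}

theorem calW_ext {u v : D.CalW} (h : u.toF = v.toF) (h' : u.timeDeriv = v.timeDeriv) : u = v := by
  refine Subtype.ext ?_
  refine (WithLp.ofLp_injective 2) (Prod.ext h h')

variable (D)

theorem isTimeDeriv_tens (v : D.FSpace) (ξ : ℝ → ℝ) (hξ : ContDiff ℝ ∞ ξ)
    (hc : HasCompactSupport ξ) :
    D.IsTimeDeriv (tens v (testLp ξ hξ.continuous hc))
      (tens (D.pivot v) (testLp (deriv ξ) (hξ.continuous_deriv (by simp)) hc.deriv)) := by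
  rw [isTimeDeriv_iff]
  intro w ζ hζ hcζ
  have hd : Continuous (deriv ξ) := hξ.continuous_deriv (by simp)
  have hdζ : Continuous (deriv ζ) := hζ.continuous_deriv (by simp)
  have hi : ∀ {a b : ℝ → ℝ}, Continuous a → Continuous b → HasCompactSupport a →
      Integrable (a * b) := fun ha hb h => (ha.mul hb).integrable_of_hasCompactSupport h.mul_right
  rw [pairing_tens, inner_toH_tens]
  have e1 : ∫ t, tens (D.pivot v) (testLp (deriv ξ) hd hc.deriv) t w * ζ t
      = D.pivot v w * ∫ t, deriv ξ t * ζ t := by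
    rw [← integral_const_mul]
    refine integral_congr_ae ?_
    filter_upwards [coeFn_tens_testLp (D.pivot v) (deriv ξ) hd hc.deriv] with t h
    rw [h, smul_apply, smul_eq_mul]
    ring
  have e2 : ∫ t, D.pivot (tens v (testLp ξ hξ.continuous hc) t) w * deriv ζ t
      = D.pivot v w * ∫ t, ξ t * deriv ζ t := by
    rw [← integral_const_mul]
    refine integral_congr_ae ?_
    filter_upwards [coeFn_tens_testLp v ξ hξ.continuous hc] with t h
    rw [h, map_smul, smul_apply, smul_eq_mul]
    ring
  rw [e1, e2, integral_mul_deriv_eq_deriv_mul_of_integrable (u := ξ) (v := ζ) (u' := deriv ξ)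
    (v' := deriv ζ) (fun x _ => ((hξ.differentiable (by simp)) x).hasDerivAt)
    (fun x _ => ((hζ.differentiable (by simp)) x).hasDerivAt) (hi hξ.continuous hdζ hc)
    (hi hd hζ.continuous hc.deriv) (hi hξ.continuous hζ.continuous hc)]
  ring

/-- For a tensor the translation moves onto the smooth factor `ξ(t - s)`, where it can be
differentiated; the definition of `∂_t u` then identifies the result. -/
theorem hasDerivAt_inner_shift_of_mem_span (u : D.CalW) {ψ : D.CalF}
    (hψ : ψ ∈ Submodule.span ℝ {ψ : D.CalF | ∃ (v : D.FSpace) (ξ : ℝ → ℝ)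
      (hξ : ContDiff ℝ ∞ ξ) (hc : HasCompactSupport ξ),
        ψ = tens v (testLp ξ hξ.continuous hc)}) (s : ℝ) :
    HasDerivAt (fun s => ⟪shift s (D.toH u.toF), D.toH ψ⟫_ℝ)
      (D.pairing u.timeDeriv (shift (-s) ψ)) s := by
  simp only [pairing_eq_inner]
  induction hψ using Submodule.span_induction with
  | mem ψ h =>
    obtain ⟨v, ξ, hξ, hc, rfl⟩ := h
    have hu : LocallyIntegrable fun t => D.pivot (u.toF t) v := by
      have h1 : MemLp (fun t => D.pivot (u.toF t) v) 2 volume :=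
        (ContinuousLinearMap.apply ℝ ℝ v).comp_memLp' (D.pivot.comp_memLp' (Lp.memLp u.toF))
      exact h1.locallyIntegrable (by norm_num)
    have h := hasDerivAt_integral_mul_translate hu hξ hc s
    have e1 : (fun s => ⟪shift s (D.toH u.toF), D.toH (tens v (testLp ξ hξ.continuous hc))⟫_ℝ)
        = fun s => ∫ t, D.pivot (u.toF t) v * ξ (t - s) := by
      funext s
      rw [inner_shift, ← toH_shift, shift_tens s v hξ hc, inner_toH_tens]
    have hd : deriv (fun t => ξ (t - s)) = fun t => deriv ξ (t - s) := by
      funext t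
      exact deriv_comp_sub_const ξ s t
    have e2 : -∫ t, D.pivot (u.toF t) v * deriv ξ (t - s)
        = ⟪D.rieszInvL u.timeDeriv, shift (-s) (tens v (testLp ξ hξ.continuous hc))⟫_ℝ := by
      rw [shift_tens s v hξ hc, ← pairing_eq_inner, (D.isTimeDeriv_iff u.toF u.timeDeriv).1 u.2 v _
        (translate_test hξ hc s).1 (translate_test hξ hc s).2, inner_toH_tens]
      simp only [hd]
    rw [e1, ← e2]
    exact h
  | zero => simpa using hasDerivAt_const s (0 : ℝ)
  | add a b _ _ ha hb => 
    simp only [map_add, inner_add_right]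
    exact ha.add hb
  | smul r a _ ha => 
    simp only [map_smul, real_inner_smul_right]
    exact ha.const_mul r

/-- On the span of tensors this is the mean value inequality. The constant depends on `ψ` only
through its norm in `𝓕`, so the bound extends by density. -/
theorem abs_inner_shift_sub_le (u : D.CalW) (ψ : D.CalF) (s : ℝ) :
    |⟪shift s (D.toH u.toF), D.toH ψ⟫_ℝ - ⟪D.toH u.toF, D.toH ψ⟫_ℝ|
      ≤ ‖D.rieszInvL u.timeDeriv‖ * ‖ψ‖ * |s| := by
  have hcl : IsClosed {ψ : D.CalF |
      |⟪shift s (D.toH u.toF), D.toH ψ⟫_ℝ - ⟪D.toH u.toF, D.toH ψ⟫_ℝ|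
        ≤ ‖D.rieszInvL u.timeDeriv‖ * ‖ψ‖ * |s|} :=
    isClosed_le (by fun_prop) (by fun_prop)
  have hmem : ψ ∈ closure (Submodule.span ℝ {ψ : D.CalF | ∃ (v : D.FSpace) (ξ : ℝ → ℝ)
      (hξ : ContDiff ℝ ∞ ξ) (hc : HasCompactSupport ξ),
        ψ = tens v (testLp ξ hξ.continuous hc)} : Set D.CalF) := by
    rw [← Submodule.topologicalClosure_coe, span_tens_dense]
    trivial
  refine hcl.closure_subset_iff.2 ?_ hmem
  intro ψ hψ
  have h := Convex.norm_image_sub_le_of_norm_hasDerivWithin_le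
    (f := fun s => ⟪shift s (D.toH u.toF), D.toH ψ⟫_ℝ)
    (f' := fun s => D.pairing u.timeDeriv (shift (-s) ψ)) (s := Set.univ)
    (C := ‖D.rieszInvL u.timeDeriv‖ * ‖ψ‖) (x := 0) (y := s)
    (fun r _ => (D.hasDerivAt_inner_shift_of_mem_span u hψ r).hasDerivWithinAt)
    (fun r _ => by
      rw [pairing_eq_inner]
      refine (norm_inner_le_norm _ _).trans_eq ?_
      rw [LinearIsometry.norm_map]) convex_univ trivial trivial
  rw [Set.mem_ofPred_eq]
  simpa only [shift_zero, sub_zero, Real.norm_eq_abs] using h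

/-- The time derivative is the derivative of the translations. -/
theorem hasDerivAt_inner_shift (u : D.CalW) (ψ : D.CalF) :
    HasDerivAt (fun s => ⟪shift s (D.toH u.toF), D.toH ψ⟫_ℝ) (D.pairing u.timeDeriv ψ) 0 := by
  rw [hasDerivAt_iff_isLittleO_nhds_zero, Asymptotics.isLittleO_iff]
  intro c hc
  set M := ‖D.rieszInvL u.timeDeriv‖ with hM
  have hM0 : 0 ≤ M := norm_nonneg _
  have hmem : ψ ∈ closure (Submodule.span ℝ {ψ : D.CalF | ∃ (v : D.FSpace) (ξ : ℝ → ℝ)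
      (hξ : ContDiff ℝ ∞ ξ) (hc : HasCompactSupport ξ),
        ψ = tens v (testLp ξ hξ.continuous hc)} : Set D.CalF) := by
    rw [← Submodule.topologicalClosure_coe, span_tens_dense]
    trivial
  -- The two errors from replacing `ψ` by `ψ'` cost `c / 4` each and the derivative for `ψ'` costs
  -- `c / 2`; `M + 1` avoids division by zero.
  obtain ⟨ψ', hψ', hdist⟩ := Metric.mem_closure_iff.1 hmem (c / (4 * (M + 1))) (by positivity)
  rw [dist_eq_norm] at hdist
  have h1 := D.hasDerivAt_inner_shift_of_mem_span u hψ' 0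
  rw [hasDerivAt_iff_isLittleO_nhds_zero, Asymptotics.isLittleO_iff] at h1
  filter_upwards [h1 (half_pos hc)] with s hs
  simp only [zero_add, neg_zero, shift_zero, smul_eq_mul, Real.norm_eq_abs] at hs ⊢
  have h2 := D.abs_inner_shift_sub_le u (ψ - ψ') s
  have h3 : |s * D.pairing u.timeDeriv (ψ - ψ')| ≤ M * ‖ψ - ψ'‖ * |s| := by
    rw [abs_mul, mul_comm, pairing_eq_inner]
    exact mul_le_mul_of_nonneg_right (abs_real_inner_le_norm _ _) (abs_nonneg _)
  have h4 : M * ‖ψ - ψ'‖ ≤ c / 4 := by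
    calc M * ‖ψ - ψ'‖ ≤ (M + 1) * (c / (4 * (M + 1))) :=
          mul_le_mul (by linarith) hdist.le (norm_nonneg _) (by linarith)
      _ = c / 4 := by field_simp
  have h5 : M * ‖ψ - ψ'‖ * |s| ≤ c / 4 * |s| := mul_le_mul_of_nonneg_right h4 (abs_nonneg _)
  simp only [map_sub, inner_sub_right, pairing_eq_inner] at h2 h3 hs ⊢
  rw [← hM] at h2
  rw [abs_le] at *
  constructor <;> nlinarith [h2.1, h2.2, h3.1, h3.2, hs.1, hs.2]

/-- By Cauchy–Schwarz `(u(· + s), u)` is maximal at `s = 0`. -/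
theorem pairing_self (u : D.CalW) : D.pairing u.timeDeriv u.toF = 0 := by
  refine IsLocalMax.hasDerivAt_eq_zero ?_ (D.hasDerivAt_inner_shift u u.toF)
  refine Eventually.of_forall fun s => ?_
  dsimp only
  rw [shift_zero, real_inner_self_eq_norm_sq, sq]
  refine (real_inner_le_norm _ _).trans_eq ?_
  rw [LinearIsometry.norm_map]

/-- `(u(· + s), u⁻) ≥ -(u⁻(· + s), u⁻) ≥ -‖u⁻‖²` with equality at `s = 0`, so the derivative there
vanishes. Only `u⁻ ∈ 𝓕` is needed, not `u⁻ ∈ 𝓦`. -/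
theorem pairing_negPart (u : D.CalW) {n : D.CalF} (hn : D.toH n = (D.toH u.toF)⁻) :
    D.pairing u.timeDeriv n = 0 := by
  refine IsLocalMin.hasDerivAt_eq_zero ?_ (D.hasDerivAt_inner_shift u n)
  refine Eventually.of_forall fun s => ?_
  dsimp only
  rw [shift_zero, hn, InnerLattice.inner_self_negPart]
  set f := D.toH u.toF
  have h1 : ⟪shift s f, f⁻⟫_ℝ = ⟪shift s f⁺, f⁻⟫_ℝ - ⟪shift s f⁻, f⁻⟫_ℝ := by
    rw [← inner_sub_left, ← map_sub, posPart_sub_negPart]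
  have h2 : 0 ≤ ⟪shift s f⁺, f⁻⟫_ℝ :=
    InnerLattice.inner_nonneg _ _ (shift_nonneg s (posPart_nonneg f)) (negPart_nonneg f)
  have h3 : ⟪shift s f⁻, f⁻⟫_ℝ ≤ ‖f⁻‖ ^ 2 := by
    refine (real_inner_le_norm _ _).trans_eq ?_
    rw [LinearIsometry.norm_map, sq]
  linarith

theorem pairing_skew (u v : D.CalW) :
    D.pairing u.timeDeriv v.toF = -D.pairing v.timeDeriv u.toF := by
  have h := D.pairing_self (u + v)
  have hu := D.pairing_self u
  have hv := D.pairing_self v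
  rw [← derivL_apply, ← toFL_apply] at h hu hv ⊢
  rw [← derivL_apply, ← toFL_apply]
  simp only [pairing_eq_inner, map_add, inner_add_left, inner_add_right] at *
  linarith

end TimeDeriv

end TimeDependentDirichletForm

/-! ### The resolvent: existence, estimates, positivity. -/

namespace TimeDependentDirichletForm

variable {X : Type*} [TopologicalSpace X] [MeasurableSpace X] {m : Measure X}
variable (D : TimeDependentDirichletForm m)

section Solvability

/-- The operator `-σ ∂_t + 𝓐_β`, with values in `𝓕' ≃ 𝓕`. -/
def opS (σ β : ℝ) : D.CalW →L[ℝ] D.CalF :=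
  (D.opA β).comp D.toFL - σ • D.rieszInvL.comp D.derivL

theorem inner_opS (σ β : ℝ) (u : D.CalW) (ψ : D.CalF) :
    ⟪D.opS σ β u, ψ⟫_ℝ = -(σ * D.pairing u.timeDeriv ψ) + D.formA β u.toF ψ := by
  rw [opS, sub_apply, inner_sub_left, smul_apply, real_inner_smul_left,
    ContinuousLinearMap.comp_apply, ContinuousLinearMap.comp_apply, inner_opA, pairing_eq_inner,
    toFL_apply, derivL_apply]
  ring

theorem inner_opS_self (σ β : ℝ) (u : D.CalW) :
    ⟪D.opS σ β u, u.toF⟫_ℝ = D.formA β u.toF u.toF := by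
  rw [inner_opS, pairing_self, mul_zero, neg_zero, zero_add]

theorem formWF_eq (β : ℝ) (u : D.CalW) (ψ : D.CalF) : D.formWF β u ψ = ⟪D.opS 1 β u, ψ⟫_ℝ := by
  rw [inner_opS, one_mul, formWF]

theorem formFW_eq (β : ℝ) (φ : D.CalF) (ψ : D.CalW) :
    D.formFW β φ ψ = ⟪D.opS (-1) β ψ, φ⟫_ℝ := by
  rw [inner_opS, formFW, D.formA_symm β φ]
  ring

theorem formFW_toF (β : ℝ) (u ψ : D.CalW) : D.formFW β u.toF ψ = D.formWF β u ψ.toF := by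
  rw [formFW, formWF, D.pairing_skew u ψ, neg_neg]

theorem opS_add (σ β k : ℝ) (u : D.CalW) (ψ : D.CalF) :
    ⟪D.opS σ (β + k) u, ψ⟫_ℝ = ⟪D.opS σ β u, ψ⟫_ℝ + k * ⟪D.toH u.toF, D.toH ψ⟫_ℝ := by
  rw [inner_opS, inner_opS, formA, formA]
  ring

theorem toFL_injective : Function.Injective D.toFL := by
  refine (injective_iff_map_eq_zero _).2 fun u hu => ?_
  have hu' : u.toF = 0 := hu
  have h : innerSL ℝ (D.rieszInvL u.timeDeriv) = 0 := eq_zero_of_forall_tens _ fun v ξ hξ hc => by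
    rw [innerSL_apply_apply, ← pairing_eq_inner,
      (D.isTimeDeriv_iff u.toF u.timeDeriv).1 u.2 v ξ hξ hc, hu', map_zero, inner_zero_left,
      neg_zero]
  have h2 : D.rieszInvL u.timeDeriv = 0 := by
    have := congrArg (fun l => l (D.rieszInvL u.timeDeriv)) h
    simpa using this
  refine calW_ext hu' (D.ext_rieszInvL ?_)
  rw [h2]
  exact (map_zero D.rieszInvL).symm

theorem toH_toF_injective {u v : D.CalW} (h : D.toH u.toF = D.toH v.toF) : u = v :=
  D.toFL_injective (D.toH_injective h)

theorem pairing_tens_pivot (φ : D.CalF) (v : D.FSpace) (ξ : ℝ → ℝ) (hξ : Continuous ξ)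
    (hc : HasCompactSupport ξ) :
    D.pairing (tens (D.pivot v) (testLp ξ hξ hc)) φ
      = ⟪D.toH φ, D.toH (tens v (testLp ξ hξ hc))⟫_ℝ := by
  rw [inner_toH_tens]
  refine integral_congr_ae ?_
  filter_upwards [coeFn_tens_testLp (D.pivot v) ξ hξ hc] with t h
  rw [h, smul_apply, smul_eq_mul, pivot_apply, pivot_apply, real_inner_comm, mul_comm]

/-- Lions' theorem applies to the adjoint operator `opS (-σ) β`, which is coercive since `⟨∂_t w, w⟩
= 0`. It yields a solution in `𝓕` only; tested on tensors, the equation exhibits its time derivative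
in `𝓕'`. The value `σ = 1` gives the resolvent, `σ = -1` the dual one. -/
theorem exists_opS_eq {σ β : ℝ} (hσ : σ ≠ 0) (hβ : 0 < β) (f : CalH m) :
    ∃ u : D.CalW, ∀ ψ : D.CalF, ⟪D.opS σ β u, ψ⟫_ℝ = ⟪f, D.toH ψ⟫_ℝ := by
  have hc : 0 < min 1 β * D.cst⁻¹ := mul_pos (lt_min one_pos hβ) (inv_pos.2 D.cst_pos)
  obtain ⟨φ, hφ⟩ := exists_forall_inner_eq_of_coercive (D.toFL : D.CalW →ₗ[ℝ] D.CalF)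
    (D.opS (-σ) β : D.CalW →ₗ[ℝ] D.CalF) D.toFL_injective hc
    (fun w => (D.formA_coercive hβ w.toF).trans_eq (D.inner_opS_self (-σ) β w).symm)
    ((innerSL ℝ f).comp D.toH)
  have hφ' : ∀ w : D.CalW, σ * D.pairing w.timeDeriv φ + D.formA β w.toF φ
      = ⟪f, D.toH w.toF⟫_ℝ := by
    intro w
    have h := hφ w
    rw [ContinuousLinearMap.coe_coe, real_inner_comm, inner_opS] at h
    rw [← neg_neg (σ * _), ← neg_mul]
    exact h
  -- The equation forces `σ ∂_t φ = 𝓐_β φ - f`, so `-ζ` must represent the time derivative.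
  let ζ : D.CalF := σ⁻¹ • (ContinuousLinearMap.adjoint D.toH f - D.opA β φ)
  have hζ : ∀ ψ, σ * ⟪ζ, ψ⟫_ℝ = ⟪f, D.toH ψ⟫_ℝ - D.formA β φ ψ := by
    intro ψ
    rw [real_inner_smul_left, mul_inv_cancel_left₀ hσ, inner_sub_left, inner_opA,
      ContinuousLinearMap.adjoint_inner_left]
  have hd : D.IsTimeDeriv φ (-D.rieszL ζ) := by
    rw [isTimeDeriv_iff]
    intro v ξ hξ hc
    have h := hφ' (D.mkW _ _ (D.isTimeDeriv_tens v ξ hξ hc))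
    rw [mkW_toF, mkW_timeDeriv, pairing_tens_pivot, D.formA_symm] at h
    have h2 := hζ (tens v (testLp ξ hξ.continuous hc))
    rw [pairing_eq_inner, map_neg, rieszInvL_rieszL, inner_neg_left, neg_inj]
    refine mul_left_cancel₀ hσ ?_
    rw [h2]
    linarith
  refine ⟨D.mkW φ _ hd, fun ψ => ?_⟩
  rw [inner_opS, mkW_toF, mkW_timeDeriv, pairing_eq_inner, map_neg, rieszInvL_rieszL,
    inner_neg_left, mul_neg, neg_neg, hζ]
  ring

variable {D}

theorem IsResolvent.inner_eq {β : ℝ} {f : CalH m} {u : D.CalW} (h : D.IsResolvent β f u)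
    (ψ : D.CalF) : ⟪D.opS 1 β u, ψ⟫_ℝ = ⟪f, D.toH ψ⟫_ℝ := by
  rw [← formWF_eq]
  exact h ψ

theorem IsResolvent.sub {β : ℝ} {f f' : CalH m} {u u' : D.CalW} (h : D.IsResolvent β f u)
    (h' : D.IsResolvent β f' u') : D.IsResolvent β (f - f') (u - u') := fun ψ => by
  rw [formWF_eq, map_sub, inner_sub_left, inner_sub_left, h.inner_eq, h'.inner_eq]

theorem IsResolvent.mul_norm_sq_le {β : ℝ} {f : CalH m} {u : D.CalW} (h : D.IsResolvent β f u) :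
    β * ‖D.toH u.toF‖ ^ 2 ≤ ⟪f, D.toH u.toF⟫_ℝ := by
  rw [← h.inner_eq, inner_opS_self]
  exact D.le_formA β u.toF

theorem IsResolvent.mul_norm_le {β : ℝ} {f : CalH m} {u : D.CalW} (h : D.IsResolvent β f u) :
    β * ‖D.toH u.toF‖ ≤ ‖f‖ := by
  rcases (norm_nonneg (D.toH u.toF)).eq_or_lt with h0 | h0
  · rw [← h0, mul_zero]; exact norm_nonneg _
  · have := h.mul_norm_sq_le.trans (real_inner_le_norm _ _)
    exact le_of_mul_le_mul_right (by linarith) h0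

theorem IsResolvent.norm_toF_le {β : ℝ} (hβ : 0 < β) {f : CalH m} {u : D.CalW}
    (h : D.IsResolvent β f u) : ‖u.toF‖ ≤ (min 1 β * D.cst⁻¹)⁻¹ * ‖D.toH‖ * ‖f‖ := by
  have hc : 0 < min 1 β * D.cst⁻¹ := mul_pos (lt_min one_pos hβ) (inv_pos.2 D.cst_pos)
  rw [mul_assoc, le_inv_mul_iff₀ hc]
  rcases (norm_nonneg u.toF).eq_or_lt with h0 | h0
  · rw [← h0, mul_zero]; positivity
  · have h1 := D.formA_coercive hβ u.toF
    rw [← D.inner_opS_self 1, h.inner_eq] at h1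
    have h2 := (real_inner_le_norm f (D.toH u.toF)).trans
      (mul_le_mul_of_nonneg_left (D.toH.le_opNorm u.toF) (norm_nonneg f))
    exact le_of_mul_le_mul_right (by linarith) h0

/-- The equation recovers `∂_t u` continuously from `u` and `f`, which upgrades convergence in `𝓕`
to convergence in `𝓦`. -/
theorem IsResolvent.timeDeriv_eq {β : ℝ} {f : CalH m} {u : D.CalW} (h : D.IsResolvent β f u) :
    u.timeDeriv = D.rieszL (D.opA β u.toF - ContinuousLinearMap.adjoint D.toH f) := by
  refine D.ext_rieszInvL (ext_inner_right ℝ fun ψ => ?_)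
  rw [rieszInvL_rieszL, inner_sub_left, ContinuousLinearMap.adjoint_inner_left, ← h.inner_eq,
    inner_opS, inner_opA, pairing_eq_inner]
  ring

/-- Test with `u⁻`: the derivative term vanishes, and `β ‖u⁻‖² ≤ -𝓐_β(u, u⁻) = -(f, u⁻) ≤ 0`. -/
theorem nonneg_of_inner_opS {σ β : ℝ} (hβ : 0 < β) {f : CalH m} {u : D.CalW}
    (h : ∀ ψ : D.CalF, ⟪D.opS σ β u, ψ⟫_ℝ = ⟪f, D.toH ψ⟫_ℝ) (hf : 0 ≤ f) :
    0 ≤ D.toH u.toF := by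
  obtain ⟨n, hn⟩ := D.exists_toH_eq_negPart u.toF
  have h1 := h n
  rw [inner_opS, D.pairing_negPart u hn, mul_zero, neg_zero, zero_add] at h1
  have h2 := D.formA_negPart_le β hn
  have h3 : 0 ≤ ⟪f, D.toH n⟫_ℝ := by
    rw [hn]; exact InnerLattice.inner_nonneg _ _ hf (negPart_nonneg _)
  have h4 : ‖D.toH n‖ ^ 2 ≤ 0 := by
    have : β * ‖D.toH n‖ ^ 2 ≤ β * 0 := by linarith
    exact le_of_mul_le_mul_left this hβ
  have h5 : ‖D.toH n‖ = 0 := by nlinarith [norm_nonneg (D.toH n)]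
  rw [hn, norm_eq_zero] at h5
  exact negPart_eq_zero.1 h5

theorem tendsto_of_isResolvent {ι : Type*} {l : Filter ι} {β : ℝ} (hβ : 0 < β)
    {f : ι → CalH m} {f₀ : CalH m} {u : ι → D.CalW} {u₀ : D.CalW}
    (hu : ∀ᶠ i in l, D.IsResolvent β (f i) (u i)) (hu₀ : D.IsResolvent β f₀ u₀)
    (hf : Tendsto f l (𝓝 f₀)) : Tendsto u l (𝓝 u₀) := by
  have h1 : Tendsto (fun i => (u i).toF) l (𝓝 u₀.toF) := by
    rw [tendsto_iff_norm_sub_tendsto_zero] at hf ⊢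
    have h := hf.const_mul ((min 1 β * D.cst⁻¹)⁻¹ * ‖D.toH‖)
    rw [mul_zero] at h
    refine squeeze_zero' (Eventually.of_forall fun i => norm_nonneg _) ?_ h
    filter_upwards [hu] with i hi
    exact (hi.sub hu₀).norm_toF_le hβ
  have h2 : Tendsto (fun i => (u i).timeDeriv) l (𝓝 u₀.timeDeriv) := by
    have h : Tendsto (fun i => D.rieszL (D.opA β (u i).toF
        - ContinuousLinearMap.adjoint D.toH (f i))) l (𝓝 u₀.timeDeriv) := by
      rw [hu₀.timeDeriv_eq]
      refine (D.rieszL.continuous.tendsto _).comp ?_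
      exact (((D.opA β).continuous.tendsto _).comp h1).sub
        (((ContinuousLinearMap.adjoint D.toH).continuous.tendsto _).comp hf)
    refine h.congr' ?_
    filter_upwards [hu] with i hi
    exact hi.timeDeriv_eq.symm
  rw [tendsto_subtype_rng]
  exact ((WithLp.prodContinuousLinearEquiv 2 ℝ D.CalF D.CalF').symm.continuous.tendsto _).comp
    (h1.prodMk_nhds h2)

variable (D)

theorem exists_isResolvent {β : ℝ} (hβ : 0 < β) (f : CalH m) : ∃ u : D.CalW, D.IsResolvent β f u :=
  (D.exists_opS_eq one_ne_zero hβ f).imp fun u h ψ => by rw [formWF_eq, h]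

/-- Positivity can be tested against the nonnegative elements of `𝓦`. -/
theorem nonneg_of_formFW_nonneg {β : ℝ} (hβ : 0 < β) {φ : D.CalF}
    (h : ∀ ψ : D.CalW, 0 ≤ D.toH ψ.toF → 0 ≤ D.formFW β φ ψ) : 0 ≤ D.toH φ := by
  refine InnerLattice.nonneg_of_forall_inner fun χ hχ => ?_
  -- Duality: `ψ` is the dual resolvent of `χ`, so it is nonnegative and `𝓔_β(φ, ψ) = (χ, φ)`.
  obtain ⟨ψ, hψ⟩ := D.exists_opS_eq (σ := -1) (by norm_num) hβ χ
  have h0 : 0 ≤ D.toH ψ.toF := nonneg_of_inner_opS hβ hψ hχ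
  have h1 := h ψ h0
  rwa [formFW_eq, hψ, real_inner_comm] at h1

end Solvability

end TimeDependentDirichletForm

/-! ### The penalised equation: solvability and comparison. -/

namespace TimeDependentDirichletForm

variable {X : Type*} [TopologicalSpace X] [MeasurableSpace X] {m : Measure X}
variable (D : TimeDependentDirichletForm m)

section Penalization

theorem integrable_formWF_sub (α : ℝ) (f : CalH m) (u : D.CalW) (ψ : D.CalF) :
    Integrable (fun t => -(u.timeDeriv t (ψ t)) + (D.form t (u.toF t) (ψ t)
      + α * ⟪D.incl (u.toF t), D.incl (ψ t)⟫_ℝ) - ⟪f t, D.incl (ψ t)⟫_ℝ) ∧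
    D.formWF α u ψ - ⟪f, D.toH ψ⟫_ℝ = ∫ t, (-(u.timeDeriv t (ψ t)) + (D.form t (u.toF t) (ψ t)
      + α * ⟪D.incl (u.toF t), D.incl (ψ t)⟫_ℝ) - ⟪f t, D.incl (ψ t)⟫_ℝ) := by
  have h1 : Integrable fun t => u.timeDeriv t (ψ t) := by
    refine (L2.integrable_inner (𝕜 := ℝ) (D.rieszInvL u.timeDeriv) ψ).congr ?_
    filter_upwards [ContinuousLinearMap.coeFn_compLpL
      (D.riesz.symm : StrongDual ℝ D.FSpace →L[ℝ] D.FSpace) u.timeDeriv] with t h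
    rw [rieszInvL, h]
    exact D.inner_riesz_symm _ _
  have h2 := D.integrable_form u.toF ψ
  have h3 : ∀ g : CalH m, Integrable fun t => ⟪g t, D.incl (ψ t)⟫_ℝ := by
    intro g
    refine (L2.integrable_inner (𝕜 := ℝ) g (D.toH ψ)).congr ?_
    filter_upwards [D.coeFn_toH ψ] with t h
    rw [h]
  have e4 : (fun t => ⟪D.toH u.toF t, D.incl (ψ t)⟫_ℝ)
      =ᵐ[volume] fun t => ⟪D.incl (u.toF t), D.incl (ψ t)⟫_ℝ := by
    filter_upwards [D.coeFn_toH u.toF] with t h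
    rw [h]
  have h4 := ((h3 (D.toH u.toF)).congr e4).const_mul α
  have h5 := h1.neg
  refine ⟨(h5.add (h2.add h4)).sub (h3 f), ?_⟩
  have e := integral_sub (h5.add (h2.add h4)) (h3 f)
  have e' := integral_add h5 (h2.add h4)
  have e'' := integral_add h2 h4
  simp only [Pi.add_apply, Pi.neg_apply] at e e' e''
  rw [e, e', e'', integral_neg, integral_const_mul, formWF, formA, inner_toH, inner_toH, pairing,
    integral_congr_ae e4]

/-- Testing with `1_s(t) v` makes the integral of the defect vanish over every set `s` of finite
measure; conversely, tensors suffice as test functions. The null set may depend on `v`. -/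
theorem isResolvent_iff_forall_ae (α : ℝ) (f : CalH m) (u : D.CalW) :
    D.IsResolvent α f u ↔ ∀ v : D.FSpace, ∀ᵐ t : ℝ,
      -(u.timeDeriv t v) + (D.form t (u.toF t) v + α * ⟪D.incl (u.toF t), D.incl v⟫_ℝ)
        = ⟪f t, D.incl v⟫_ℝ := by
  have key : ∀ (v : D.FSpace) (ξ : Lp ℝ 2 (volume : Measure ℝ)),
      (fun t => -(u.timeDeriv t (tens v ξ t)) + (D.form t (u.toF t) (tens v ξ t)
        + α * ⟪D.incl (u.toF t), D.incl (tens v ξ t)⟫_ℝ) - ⟪f t, D.incl (tens v ξ t)⟫_ℝ)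
      =ᵐ[volume] fun t => ξ t * (-(u.timeDeriv t v) + (D.form t (u.toF t) v
        + α * ⟪D.incl (u.toF t), D.incl v⟫_ℝ) - ⟪f t, D.incl v⟫_ℝ) := by
    intro v ξ
    filter_upwards [coeFn_tens v ξ] with t h
    rw [h]
    simp only [map_smul, real_inner_smul_right, smul_eq_mul]
    ring
  constructor
  · intro h v
    have hs : ∀ s : Set ℝ, MeasurableSet s → volume s < ⊤ →
        IntegrableOn (fun t => -(u.timeDeriv t v) + (D.form t (u.toF t) v
          + α * ⟪D.incl (u.toF t), D.incl v⟫_ℝ) - ⟪f t, D.incl v⟫_ℝ) s ∧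
        ∫ t in s, (-(u.timeDeriv t v) + (D.form t (u.toF t) v
          + α * ⟪D.incl (u.toF t), D.incl v⟫_ℝ) - ⟪f t, D.incl v⟫_ℝ) = 0 := by
      intro s hs hμ
      have e : (fun t => (indicatorConstLp 2 hs hμ.ne (1 : ℝ) : Lp ℝ 2 (volume : Measure ℝ)) t
          * (-(u.timeDeriv t v) + (D.form t (u.toF t) v
          + α * ⟪D.incl (u.toF t), D.incl v⟫_ℝ) - ⟪f t, D.incl v⟫_ℝ))
          =ᵐ[volume] s.indicator fun t => -(u.timeDeriv t v) + (D.form t (u.toF t) v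
          + α * ⟪D.incl (u.toF t), D.incl v⟫_ℝ) - ⟪f t, D.incl v⟫_ℝ := by
        filter_upwards [indicatorConstLp_coeFn (p := 2) (hs := hs) (hμs := hμ.ne) (c := (1 : ℝ))]
          with t ht
        rw [ht]
        by_cases hts : t ∈ s <;> simp [hts]
      obtain ⟨h1, h2⟩ := D.integrable_formWF_sub α f u
        (tens v (indicatorConstLp 2 hs hμ.ne (1 : ℝ)))
      refine ⟨(integrable_indicator_iff hs).1 (h1.congr ((key v _).trans e)), ?_⟩
      rw [← integral_indicator hs, ← integral_congr_ae ((key v _).trans e), ← h2, h, sub_self]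
    have h0 := ae_eq_zero_of_forall_setIntegral_eq_of_sigmaFinite
      (fun s h1 h2 => (hs s h1 h2).1) (fun s h1 h2 => (hs s h1 h2).2)
    filter_upwards [h0] with t ht
    exact sub_eq_zero.1 ht
  · intro h
    have h0 : innerSL ℝ (D.opS 1 α u - ContinuousLinearMap.adjoint D.toH f) = 0 := by
      refine eq_zero_of_forall_tens _ fun v ξ hξ hc => ?_
      rw [innerSL_apply_apply, inner_sub_left, ContinuousLinearMap.adjoint_inner_left, ← formWF_eq,
        (D.integrable_formWF_sub α f u _).2, integral_congr_ae (key v _)]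
      refine integral_eq_zero_of_ae ?_
      filter_upwards [h v] with t ht
      rw [ht, sub_self, mul_zero]
      rfl
    intro ψ
    have h1 := congrArg (fun l => l ψ) h0
    simp only [innerSL_apply_apply, inner_sub_left, ContinuousLinearMap.adjoint_inner_left,
      ← formWF_eq, zero_apply] at h1
    exact sub_eq_zero.1 h1

theorem isPenalized_iff (α ε : ℝ) (g : CalH m) (u : D.CalW) :
    D.IsPenalized α ε g u ↔ D.IsResolvent α (ε⁻¹ • (D.toH u.toF - g)⁻) u := by
  rw [isResolvent_iff_forall_ae]
  refine forall_congr' fun v => ?_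
  have hs := Lp.coeFn_smul ε⁻¹ ((D.toH u.toF - g)⁻)
  constructor
  · intro h
    filter_upwards [h, hs] with t h1 h2
    rw [h1, h2, Pi.smul_apply, real_inner_smul_left]
  · intro h
    filter_upwards [h, hs] with t h1 h2
    rw [h1, h2, Pi.smul_apply, real_inner_smul_left]

theorem add_negPart_sub {E : Type*} [AddCommGroup E] [Lattice E] [IsOrderedAddMonoid E]
    (a b : E) : a + (a - b)⁻ = a ⊔ b := by
  rw [← posPart_neg, neg_sub, ← sup_eq_add_posPart_sub, sup_comm]

/-- Add `k (u, ψ)` to both sides and use `u + (u - g)⁻ = u ∨ g`. The new right-hand side is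
increasing and `k`-Lipschitz in `u`. -/
theorem isResolvent_negPart_iff (α k : ℝ) (g : CalH m) (u : D.CalW) :
    D.IsResolvent α (k • (D.toH u.toF - g)⁻) u
      ↔ D.IsResolvent (α + k) (k • (D.toH u.toF ⊔ g)) u := by
  refine forall_congr' fun ψ => ?_
  rw [formWF_eq, formWF_eq, opS_add, ← add_negPart_sub, smul_add, inner_add_left,
    real_inner_smul_left (D.toH u.toF), add_comm, add_right_inj]

variable {D}

theorem IsPenalized.sub_inner {α ε ε' : ℝ} {g : CalH m} {u u' : D.CalW}
    (h : D.IsPenalized α ε g u) (h' : D.IsPenalized α ε' g u') :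
    α * ‖D.toH u.toF - D.toH u'.toF‖ ^ 2
      ≤ ⟪ε⁻¹ • (D.toH u.toF - g)⁻ - ε'⁻¹ • (D.toH u'.toF - g)⁻,
        (D.toH u.toF - g) - (D.toH u'.toF - g)⟫_ℝ := by
  have h1 := (((D.isPenalized_iff _ _ _ _).1 h).sub ((D.isPenalized_iff _ _ _ _).1 h')).mul_norm_sq_le
  have e : D.toH (u - u').toF = D.toH u.toF - D.toH u'.toF := map_sub D.toH u.toF u'.toF
  rw [e] at h1
  rwa [sub_sub_sub_cancel_right]

theorem IsPenalized.unique {α ε : ℝ} (hα : 0 < α) (hε : 0 < ε) {g : CalH m} {u u' : D.CalW}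
    (h : D.IsPenalized α ε g u) (h' : D.IsPenalized α ε g u') : u = u' := by
  have h1 := h.sub_inner h'
  rw [← smul_sub, real_inner_smul_left] at h1
  have h2 := InnerLattice.negPart_inner_mono_nonneg (D.toH u.toF - g) (D.toH u'.toF - g)
  rw [← neg_sub (D.toH u.toF - g)⁻, inner_neg_left] at h2
  have h3 : ε⁻¹ * ⟪(D.toH u.toF - g)⁻ - (D.toH u'.toF - g)⁻,
      (D.toH u.toF - g) - (D.toH u'.toF - g)⟫_ℝ ≤ 0 :=
    mul_nonpos_of_nonneg_of_nonpos (inv_nonneg.2 hε.le) (by linarith)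
  have h4 : ‖D.toH u.toF - D.toH u'.toF‖ ^ 2 ≤ 0 := by
    have : α * ‖D.toH u.toF - D.toH u'.toF‖ ^ 2 ≤ α * 0 := by linarith
    exact le_of_mul_le_mul_left this hα
  have h5 : ‖D.toH u.toF - D.toH u'.toF‖ = 0 := by
    nlinarith [norm_nonneg (D.toH u.toF - D.toH u'.toF)]
  exact D.toH_toF_injective (sub_eq_zero.1 (norm_eq_zero.1 h5))

variable (D)

/-- Since `β G_β` is a contraction and `x ↦ x ∨ g` is nonexpansive, `x ↦ G_{α+1/ε}(ε⁻¹ (x ∨ g))` has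
Lipschitz constant `ε⁻¹ / (α + ε⁻¹) < 1`. -/
theorem exists_isPenalized {α ε : ℝ} (hα : 0 < α) (hε : 0 < ε) (g : CalH m) :
    ∃ u : D.CalW, D.IsPenalized α ε g u := by
  have hk : 0 < ε⁻¹ := inv_pos.2 hε
  have hβ : 0 < α + ε⁻¹ := by positivity
  choose R hR using fun x : CalH m => D.exists_isResolvent hβ (ε⁻¹ • (x ⊔ g))
  have hlip : LipschitzWith (Real.toNNReal (ε⁻¹ / (α + ε⁻¹))) fun x => D.toH (R x).toF := by
    refine LipschitzWith.of_dist_le_mul fun x y => ?_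
    rw [dist_eq_norm, dist_eq_norm, Real.coe_toNNReal _ (by positivity), div_mul_eq_mul_div,
      le_div_iff₀ hβ, mul_comm]
    have h := ((hR x).sub (hR y)).mul_norm_le
    have e : D.toH (R x - R y).toF = D.toH (R x).toF - D.toH (R y).toF := map_sub D.toH _ _
    rw [e] at h
    refine h.trans ?_
    rw [← smul_sub, norm_smul, Real.norm_of_nonneg hk.le]
    exact mul_le_mul_of_nonneg_left (norm_sup_sub_sup_le_norm x y g) hk.le
  have hc : ContractingWith (Real.toNNReal (ε⁻¹ / (α + ε⁻¹))) fun x => D.toH (R x).toF := by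
    refine ⟨?_, hlip⟩
    rw [Real.toNNReal_lt_one, div_lt_one hβ]
    linarith
  let x := ContractingWith.fixedPoint _ hc
  have hx : D.toH (R x).toF = x := hc.fixedPoint_isFixedPt
  refine ⟨R x, ?_⟩
  rw [isPenalized_iff, isResolvent_negPart_iff, hx]
  exact hR x

theorem sup_sub_sup_le_posPart {E : Type*} [AddCommGroup E] [Lattice E] [IsOrderedAddMonoid E]
    (a b c : E) : a ⊔ c - b ⊔ c ≤ (a - b)⁺ := by
  rw [sub_le_iff_le_add]
  refine sup_le ?_ ?_
  · calc a = (a - b) + b := by abel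
      _ ≤ (a - b)⁺ + b ⊔ c := add_le_add (le_posPart _) le_sup_left
  · calc c ≤ b ⊔ c := le_sup_right
      _ ≤ (a - b)⁺ + b ⊔ c := le_add_of_nonneg_left (posPart_nonneg _)

/-- A supersolution dominates the solution of the penalised equation. -/
theorem le_of_supersolution {α ε : ℝ} (hα : 0 < α) (hε : 0 < ε) {g : CalH m} {u : D.CalW}
    (hu : D.IsPenalized α ε g u) {v : D.CalF}
    (hv : ∀ ψ : D.CalW, 0 ≤ D.toH ψ.toF →
      ⟪ε⁻¹ • (D.toH v - g)⁻, D.toH ψ.toF⟫_ℝ ≤ D.formFW α v ψ) :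
    D.toH u.toF ≤ D.toH v := by
  have hk : 0 < ε⁻¹ := inv_pos.2 hε
  have hβ : 0 < α + ε⁻¹ := by positivity
  rw [isPenalized_iff, isResolvent_negPart_iff] at hu
  set a := (D.toH u.toF - D.toH v)⁺ with ha
  have ha0 : 0 ≤ a := posPart_nonneg _
  -- The inequality for `v` is available only against test functions in `𝓦`, to which `(u - v)⁺`
  -- need not belong. Instead, `z` compensates the difference of the right-hand sides, so that `v -
  -- u + z ≥ 0` by duality and hence `a ≤ z`; but `z` is smaller than `a` in norm unless `a = 0`.
  obtain ⟨z, hz⟩ := D.exists_isResolvent hβ (ε⁻¹ • a)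
  have hz0 : 0 ≤ D.toH z.toF :=
    nonneg_of_inner_opS hβ hz.inner_eq (InnerLattice.smul_nonneg' hk.le ha0)
  have hw : 0 ≤ D.toH (v - u.toF + z.toF) := by
    refine D.nonneg_of_formFW_nonneg hβ fun ψ hψ => ?_
    have e1 : D.formFW (α + ε⁻¹) u.toF ψ = ⟪ε⁻¹ • (D.toH u.toF ⊔ g), D.toH ψ.toF⟫_ℝ := by
      rw [formFW_toF, hu]
    have e2 : D.formFW (α + ε⁻¹) z.toF ψ = ⟪ε⁻¹ • a, D.toH ψ.toF⟫_ℝ := by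
      rw [formFW_toF, hz]
    have e3 : ⟪ε⁻¹ • (D.toH v ⊔ g), D.toH ψ.toF⟫_ℝ ≤ D.formFW (α + ε⁻¹) v ψ := by
      have h := hv ψ hψ
      rw [formFW_eq] at h ⊢
      rw [opS_add, ← add_negPart_sub, smul_add, inner_add_left, real_inner_smul_left (D.toH v),
        real_inner_comm (D.toH v)]
      linarith
    have e4 : D.formFW (α + ε⁻¹) (v - u.toF + z.toF) ψ = D.formFW (α + ε⁻¹) v ψ
        - D.formFW (α + ε⁻¹) u.toF ψ + D.formFW (α + ε⁻¹) z.toF ψ := by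
      simp only [formFW_eq, inner_add_right, inner_sub_right]
    have e5 : 0 ≤ ⟪ε⁻¹ • (D.toH v ⊔ g) - ε⁻¹ • (D.toH u.toF ⊔ g) + ε⁻¹ • a, D.toH ψ.toF⟫_ℝ := by
      refine InnerLattice.inner_nonneg _ _ ?_ hψ
      rw [← smul_sub, ← smul_add]
      refine InnerLattice.smul_nonneg' hk.le ?_
      have := sup_sub_sup_le_posPart (D.toH u.toF) (D.toH v) g
      rw [← ha, ← sub_nonneg] at this
      refine this.trans_eq ?_
      abel
    rw [inner_add_left, inner_sub_left] at e5
    rw [e4, e1, e2]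
    linarith
  have haz : a ≤ D.toH z.toF := by
    refine sup_le ?_ hz0
    rw [map_add, map_sub] at hw
    rw [← sub_nonneg]
    refine hw.trans_eq ?_
    abel
  have hn : ‖a‖ ≤ ‖D.toH z.toF‖ := by
    refine norm_le_norm_of_abs_le_abs ?_
    rwa [abs_of_nonneg ha0, abs_of_nonneg hz0]
  have h1 := hz.mul_norm_le
  rw [norm_smul, Real.norm_of_nonneg hk.le] at h1
  have h2 : ‖a‖ = 0 := by
    have h3 : (α + ε⁻¹) * ‖a‖ ≤ ε⁻¹ * ‖a‖ := (mul_le_mul_of_nonneg_left hn hβ.le).trans h1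
    have h4 : α * ‖a‖ ≤ α * 0 := by linarith
    exact le_antisymm (le_of_mul_le_mul_left h4 hα) (norm_nonneg _)
  rw [norm_eq_zero, ha, posPart_eq_zero] at h2
  exact sub_nonpos.1 h2

/-- The solution for the smaller parameter carries the larger penalty, so it is a supersolution for
the other equation. -/
theorem IsPenalized.antitone {α ε₁ ε₂ : ℝ} (hα : 0 < α) (h₁ : 0 < ε₁) (h₂ : ε₁ ≤ ε₂)
    {g : CalH m} {u₁ u₂ : D.CalW} (hu₁ : D.IsPenalized α ε₁ g u₁)
    (hu₂ : D.IsPenalized α ε₂ g u₂) : D.toH u₂.toF ≤ D.toH u₁.toF := by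
  refine D.le_of_supersolution hα (h₁.trans_le h₂) hu₂ fun ψ hψ => ?_
  rw [formFW_toF, (D.isPenalized_iff _ _ _ _).1 hu₁, real_inner_smul_left, real_inner_smul_left]
  refine mul_le_mul_of_nonneg_right (inv_anti₀ h₁ h₂) ?_
  exact InnerLattice.inner_nonneg _ _ (negPart_nonneg _) hψ

/-- Split `a - b = (a⁺ - b⁺) - (a⁻ - b⁻)`. By orthogonality the first part pairs to something
nonpositive with `l⁻¹ a⁻ - k⁻¹ b⁻`, so the pairing with `a⁻ - b⁻` is nonpositive too. This is the
hypothesis of `exists_tendsto_of_inner_sub_nonpos` for `F l = l⁻¹ a⁻`. -/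
theorem inner_smul_negPart_sub_nonpos {E : Type*} [NormedAddCommGroup E] [InnerProductSpace ℝ E]
    [Lattice E] [HasSolidNorm E] [IsOrderedAddMonoid E] [InnerLattice E] {a b : E} {l k : ℝ}
    (hl : 0 < l) (hk : 0 < k) (h : 0 ≤ ⟪l⁻¹ • a⁻ - k⁻¹ • b⁻, a - b⟫_ℝ) :
    ⟪l⁻¹ • a⁻ - k⁻¹ • b⁻, l • l⁻¹ • a⁻ - k • k⁻¹ • b⁻⟫_ℝ ≤ 0 := by
  rw [smul_inv_smul₀ hl.ne', smul_inv_smul₀ hk.ne']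
  have h1 : ⟪l⁻¹ • a⁻ - k⁻¹ • b⁻, a⁺ - b⁺⟫_ℝ ≤ 0 := by
    have ha := InnerLattice.inner_posPart_negPart a
    have hb := InnerLattice.inner_posPart_negPart b
    have hab := InnerLattice.inner_nonneg b⁺ a⁻ (posPart_nonneg b) (negPart_nonneg a)
    have hba := InnerLattice.inner_nonneg a⁺ b⁻ (posPart_nonneg a) (negPart_nonneg b)
    rw [real_inner_comm] at ha hb hab hba
    have h2 := mul_nonneg (inv_nonneg.2 hl.le) hab
    have h3 := mul_nonneg (inv_nonneg.2 hk.le) hba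
    simp only [inner_sub_left, inner_sub_right, real_inner_smul_left, ha, hb]
    linarith
  have e : a - b = (a⁺ - b⁺) - (a⁻ - b⁻) := by
    conv_lhs => rw [← posPart_sub_negPart a, ← posPart_sub_negPart b]
    abel
  rw [e, inner_sub_right] at h
  linarith

end Penalization

end TimeDependentDirichletForm

end

/-! ### Passage to the limit `ε ↓ 0`. -/

theorem mainTheorem8 {X : Type*} [MetricSpace X] [LocallyCompactSpace X]
    [TopologicalSpace.SeparableSpace X] [MeasurableSpace X] [BorelSpace X]
    (m : Measure X) [m.Regular] [m.IsOpenPosMeasure]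
    (D : TimeDependentDirichletForm m) (α : ℝ) (hα : 0 < α)
    (g : D.CalW)
    (h_bdd : ∃ φ : D.CalW, D.IsExcessive α φ.toF ∧ |D.toH g.toF| ≤ D.toH φ.toF)
    (h_norm : ∃ K : ℝ, ∀ ε > 0, ∀ u : D.CalW, D.IsPenalized α ε (D.toH g.toF) u →
      ε⁻¹ * ‖(D.toH u.toF - D.toH g.toF)⁻‖ ≤ K * ‖D.toH g.toF‖) :
    (∀ ε > 0, ∃! u : D.CalW, D.IsPenalized α ε (D.toH g.toF) u) ∧
    ∀ gε : ℝ → D.CalW, (∀ ε > 0, D.IsPenalized α ε (D.toH g.toF) (gε ε)) →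
      ∃ e : D.CalW,
        -- monotone convergence, strongly in `𝓗`
        (∀ ε₁ > 0, ∀ ε₂ ≥ ε₁, D.toH (gε ε₂).toF ≤ D.toH (gε ε₁).toF) ∧
        Tendsto (fun ε => D.toH (gε ε).toF) (𝓝[>] 0) (𝓝 (D.toH e.toF)) ∧
        -- weak convergence in `𝓕` and in `𝓦`
        (∀ l : StrongDual ℝ D.CalF,
          Tendsto (fun ε => l (gε ε).toF) (𝓝[>] 0) (𝓝 (l e.toF))) ∧
        (∀ l : StrongDual ℝ D.CalW,
          Tendsto (fun ε => l (gε ε)) (𝓝[>] 0) (𝓝 (l e))) ∧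
        -- the variational inequality and minimality
        e.toF ∈ D.potentials α ∩ D.above (D.toH g.toF) ∧
        (∀ ψ : D.CalW, ψ.toF ∈ D.above (D.toH g.toF) →
          D.formWF α e e.toF ≤ D.formWF α e ψ.toF) ∧
        (∀ v : D.CalW, v.toF ∈ D.potentials α ∩ D.above (D.toH g.toF) →
          D.toH e.toF ≤ D.toH v.toF) := by
  refine ⟨fun ε hε => ?_, fun u hu => ?_⟩
  · obtain ⟨u, hu⟩ := D.exists_isPenalized hα hε (D.toH g.toF)
    exact ⟨u, hu, fun v hv => TimeDependentDirichletForm.IsPenalized.unique hα hε hv hu⟩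
  obtain ⟨K, hK⟩ := h_norm
  set γ := D.toH g.toF with hγ
  let f : ℝ → CalH m := fun ε => ε⁻¹ • (D.toH (u ε).toF - γ)⁻
  have hres : ∀ ε > 0, D.IsResolvent α (f ε) (u ε) := fun ε hε =>
    (D.isPenalized_iff _ _ _ _).1 (hu ε hε)
  have hfb : ∀ ε > 0, ‖f ε‖ ≤ K * ‖γ‖ := by
    intro ε hε
    rw [norm_smul, Real.norm_of_nonneg (inv_nonneg.2 hε.le)]
    exact hK ε hε (u ε) (hu ε hε)
  have hf0 : ∀ ε > 0, 0 ≤ f ε := fun ε hε =>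
    InnerLattice.smul_nonneg' (inv_nonneg.2 hε.le) (negPart_nonneg _)
  obtain ⟨f₀, hf⟩ := exists_tendsto_of_inner_sub_nonpos hfb fun l hl k hk =>
    TimeDependentDirichletForm.inner_smul_negPart_sub_nonpos hl hk
      (le_trans (by positivity)
        (TimeDependentDirichletForm.IsPenalized.sub_inner (hu l hl) (hu k hk)))
  obtain ⟨e, he⟩ := D.exists_isResolvent hα f₀
  have hpos : ∀ᶠ ε : ℝ in 𝓝[>] 0, 0 < ε := self_mem_nhdsWithin
  -- The penalties converge strongly in `𝓗`, so the convergence in `𝓦` is strong as well; the weak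
  -- statements follow from it.
  have hW : Tendsto u (𝓝[>] 0) (𝓝 e) :=
    TimeDependentDirichletForm.tendsto_of_isResolvent hα (hpos.mono fun ε hε => hres ε hε) he hf
  have hF : Tendsto (fun ε => (u ε).toF) (𝓝[>] 0) (𝓝 e.toF) := (D.toFL.continuous.tendsto e).comp hW
  have hH : Tendsto (fun ε => D.toH (u ε).toF) (𝓝[>] 0) (𝓝 (D.toH e.toF)) :=
    (D.toH.continuous.tendsto _).comp hF
  have hf₀ : 0 ≤ f₀ := ge_of_tendsto hf (hpos.mono hf0)
  have hge : γ ≤ D.toH e.toF := by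
    have h1 : Tendsto (fun ε => (D.toH (u ε).toF - γ)⁻) (𝓝[>] 0) (𝓝 (D.toH e.toF - γ)⁻) := by
      have hcont : Continuous fun x : CalH m => x⁻ := by
        simp only [negPart_def]
        exact continuous_neg.sup continuous_const
      exact (hcont.tendsto _).comp (hH.sub_const γ)
    -- `(u ε - γ)⁻ = ε • f ε`, with `f ε` convergent.
    have h2 : Tendsto (fun ε => (D.toH (u ε).toF - γ)⁻) (𝓝[>] 0) (𝓝 ((0 : ℝ) • f₀)) := by
      have h3 : Tendsto (fun ε : ℝ => ε) (𝓝[>] 0) (𝓝 0) := nhdsWithin_le_nhds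
      refine (h3.smul hf).congr' ?_
      filter_upwards [hpos] with ε hε
      exact smul_inv_smul₀ hε.ne' _
    have h3 := tendsto_nhds_unique h1 h2
    rw [zero_smul, negPart_eq_zero, sub_nonneg] at h3
    exact h3
  -- Complementarity: `(f ε, u ε - γ) = -ε⁻¹ ‖(u ε - γ)⁻‖² ≤ 0`, and both factors converge strongly.
  have hcomp : ⟪f₀, D.toH e.toF - γ⟫_ℝ ≤ 0 := by
    refine le_of_tendsto (hf.inner (hH.sub_const γ)) ?_
    filter_upwards [hpos] with ε hε
    rw [real_inner_smul_left, real_inner_comm, InnerLattice.inner_self_negPart]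
    exact mul_nonpos_of_nonneg_of_nonpos (inv_nonneg.2 hε.le) (neg_nonpos.2 (sq_nonneg _))
  refine ⟨e, fun ε₁ h₁ ε₂ h₂ => TimeDependentDirichletForm.IsPenalized.antitone D hα h₁ h₂
    (hu ε₁ h₁) (hu ε₂ (h₁.trans_le h₂)), hH, fun l => (l.continuous.tendsto _).comp hF,
    fun l => (l.continuous.tendsto _).comp hW, ⟨fun ψ hψ => ?_, hge⟩, fun ψ hψ => ?_,
    fun v hv => ?_⟩
  · rw [D.formFW_toF, he]
    exact InnerLattice.inner_nonneg _ _ hf₀ hψ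
  -- `𝓔_α(e, ψ) - 𝓔_α(e, e) = (f₀, ψ - γ) - (f₀, e - γ)`.
  · have h1 : 0 ≤ ⟪f₀, D.toH ψ.toF - γ⟫_ℝ :=
      InnerLattice.inner_nonneg _ _ hf₀ (sub_nonneg.2 hψ)
    rw [he, he]
    rw [inner_sub_right] at h1 hcomp
    linarith
  · refine le_of_tendsto hH ?_
    filter_upwards [hpos] with ε hε
    refine D.le_of_supersolution hα hε (hu ε hε) fun ψ hψ => ?_
    -- A potential above the obstacle has no penalty, so it is a supersolution for every `ε`.
    have h1 : (D.toH v.toF - γ)⁻ = 0 := negPart_eq_zero.2 (sub_nonneg.2 hv.2)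
    rw [h1, smul_zero, inner_zero_left]
    exact hv.1 ψ hψ
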